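/- For $a=(a_1,\dots,a_6)\in\mathbb{R}^6$ consider the real polynomials $$p_1(x)=a_2+(3a_3+a_4)x-(3a_2+a_5)x^2-a_6x^3,$$ $$p_2(x)=-a_3+(3a_2+a_5)x+(2a_3+a_4+a_6)x^2-a_2x^3,\qquad p_3=a_1p_1-p_2 .$$ Let $D_1,D_3,D_1',D_3'$ be the discriminants of $p_1,p_3,p_1',p_3'$, let $R_{113}=\operatorname{res}(p_1',p_3)$, $R_{133}=\operatorname{res}(p_1,p_3')$, $\bar R_{113}=\operatorname{res}(r_1,p_3)$, $\bar R_{133}=\operatorname{res}(p_1,r_3)$, where $r_1$ (resp. $r_3$) is the remainder of the division of $p_1$ by $p_1'$ (resp. of $p_3$ by $p_3'$). All these are the generic expressions in $a_1,\dots,a_6$, computed with $p_1,p_3$ of formal degree $3$, $p_1',p_3'$ of formal degree $2$, and $r_1,r_3$ of formal degree $1$. Up to sign, $\operatorname{res}(p_1,p_3)=R_1R_2$ with $R_1=(4a_2+a_5)^2+(3a_3+a_4+a_6)^2$ and $$R_2=a_3a_6l_0^2+a_2l_0l_1l_2+a_2^2(l_1-l_3)(l_1+l_3),$$ where $l_0=2a_3+a_4$,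 $l_1=2a_2+a_5$, $l_2=a_3+a_6$, $l_3=a_3-a_6$. Consider the subsets of $\mathbb{R}^6$ given by the following conditions. * 1a) $a_6=a_5=3a_3+a_4=a_2=0$. * 1b) $a_1a_6-a_2=a_1a_5-a_3+a_4+a_6=a_1(3a_3+a_4)-3a_2-a_5=a_1a_2+a_3=0$. * 2) $a_6=3a_2+a_5=0$, $(3a_3+a_4)a_2\ne0$, $R_2=0$ and $a_2^2\le 4a_3^2+4a_1a_2a_3$. * 3) $a_2-a_1a_6=2a_3+a_4+a_1(3a_2+a_5)+a_6=0$, $a_6\bigl(3a_2-a_1(3a_3+a_4)+a_5\bigr)\neq0$, and * 3a) $R_2=0$, $D_1\le0$, $R_{113}\ne0$; * 3b) $4a_4-9a_6=4a_3+5a_6=9a_2+a_5=9a_1a_6+a_5=8a_1^2-1=0$. * 4) $a_2=a_6=0$, $a_5(a_3-a_1a_5)\ne0$, $3a_3+a_4=0$ and $4a_3^2-4a_1a_3a_5\ge a_5^2$. * 5) $a_6(a_2-a_1a_6)\neq0$, $R_2=0$, and * 5a) $D_1<0$, $D_3<0$, $(a_3-a_6)\bigl(a_2^2+(a_4+2a_3)^2\bigr)\ne0$;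 * 5b) $D_1=0$, $D_3<0$, $D_1'R_{113}\neq0$; * 5c) $D_1=D_1'=0$, $D_3<0$; * 5d) $D_3=0$, $D_1<0$, $D_3'R_{133}\ne0$; * 5e) $D_3=D_3'=0$, $D_1<0$; * 5f) $D_1=D_3=0$, $D_1'D_3'\bar R_{113}\bar R_{133}\neq0$; * 5g) $D_1=D_1'=D_3=0$, $\bar R_{133}\ne0$; * 5h) $D_1=D_3=D_3'=0$, $\bar R_{113}\neq0$. Define the codimension of a non-empty set $S\subset\mathbb{R}^6$ to be $6-\dim S$, where $\dim S$ is the Krull dimension of $\mathbb{R}[x_1,\dots,x_6]/I(S)$ and $I(S)$ is the ideal of all polynomials vanishing on $S$. Then all the sets 1a)–5h) are non-empty, and * 5a) has codimension $1$; * 5b) and 5d) have codimension $2$; * 2), 3a) and 4) have codimension $3$; * 1a) and 1b) have codimension $4$; * 3b) has codimension $5$; * 5f) has codimension $2$ or $3$; * 5c), 5e), 5g) and 5h) have codimension at least $2$. -/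

import Mathlib

namespace QuadraticSystem

/-- The dimension of a semi-algebraic set `S ⊆ ℝⁿ`: the Krull dimension of
`ℝ[x₁, …, xₙ] / I(S)`, where `I(S)` is the ideal of all polynomials vanishing on `S`.
It is the dimension of the smallest real variety containing `S`; the empty set has
dimension `⊥`. -/
noncomputable def dimension {n : ℕ} (S : Set (Fin n → ℝ)) : WithBot ℕ∞ :=
  ringKrullDim (MvPolynomial (Fin n) ℝ ⧸ MvPolynomial.vanishingIdeal ℝ S)

/-- `S ⊆ ℝⁿ` has codimension `c`, i.e. `dim S = n - c`. This fails for every `c` if `S` is empty,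
as then `dim S = ⊥`. -/
def HasCodim {n : ℕ} (S : Set (Fin n → ℝ)) (c : ℕ) : Prop :=
  dimension S + (c : WithBot ℕ∞) = (n : WithBot ℕ∞)

/-! The parameters `(a₁, a₂, a₃, a₄, a₅, a₆)` of the quadratic system are
`(a 0, a 1, a 2, a 3, a 4, a 5)`. -/

/-- `p₁(x) = a₂ + (3 a₃ + a₄) x - (3 a₂ + a₅) x² - a₆ x³`, as a formal cubic. -/
def p1 (a : Fin 6 → ℝ) : Cubic ℝ where
  a := -a 5
  b := -(3 * a 1 + a 4)
  c := 3 * a 2 + a 3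
  d := a 1

/-- `p₂(x) = -a₃ + (3 a₂ + a₅) x + (2 a₃ + a₄ + a₆) x² - a₂ x³`, as a formal cubic. -/
def p2 (a : Fin 6 → ℝ) : Cubic ℝ where
  a := -a 1
  b := 2 * a 2 + a 3 + a 5
  c := 3 * a 1 + a 4
  d := -a 2

/-- `p₃ = a₁ p₁ - p₂`, as a formal cubic. -/
def p3 (a : Fin 6 → ℝ) : Cubic ℝ where
  a := a 0 * (p1 a).a - (p2 a).a
  b := a 0 * (p1 a).b - (p2 a).b
  c := a 0 * (p1 a).c - (p2 a).c
  d := a 0 * (p1 a).d - (p2 a).d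

/-- The discriminant of the derivative `3 a x² + 2 b x + c` of a formal cubic
`a x³ + b x² + c x + d`. -/
def derivDiscr (P : Cubic ℝ) : ℝ :=
  discrim (3 * P.a) (2 * P.b) P.c

/-! All discriminants and resultants below are the generic ones: they are taken for polynomials
of formal degree three (`p₁`, `p₃`), two (`p₁'`, `p₃'`) and one (`r₁`, `r₃`), and are hence the
values at `a` of fixed expressions in `a₁, …, a₆`. -/

/-- The discriminant `D₁` of `p₁`. -/
def D1 (a : Fin 6 → ℝ) : ℝ := (p1 a).discr

/-- The discriminant `D₃` of `p₃`. -/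
def D3 (a : Fin 6 → ℝ) : ℝ := (p3 a).discr

/-- The discriminant `D₁'` of `p₁'`. -/
def D1' (a : Fin 6 → ℝ) : ℝ := derivDiscr (p1 a)

/-- The discriminant `D₃'` of `p₃'`. -/
def D3' (a : Fin 6 → ℝ) : ℝ := derivDiscr (p3 a)

/-- The factor `R₁` of the resultant of `p₁` and `p₃`. -/
def R1 (a : Fin 6 → ℝ) : ℝ :=
  (4 * a 1 + a 4) ^ 2 + (3 * a 2 + a 3 + a 5) ^ 2

/-- The factor `R₂` of the resultant of `p₁` and `p₃`, namely
`a₃ a₆ l₀² + a₂ l₀ l₁ l₂ + a₂² (l₁ - l₃) (l₁ + l₃)` with `l₀ = 2 a₃ + a₄`, `l₁ = 2 a₂ + a₅`,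
`l₂ = a₃ + a₆` and `l₃ = a₃ - a₆`. -/
def R2 (a : Fin 6 → ℝ) : ℝ :=
  let l0 := 2 * a 2 + a 3
  let l1 := 2 * a 1 + a 4
  let l2 := a 2 + a 5
  let l3 := a 2 - a 5
  a 2 * a 5 * l0 ^ 2 + a 1 * l0 * l1 * l2 + a 1 ^ 2 * (l1 - l3) * (l1 + l3)

set_option maxHeartbeats 2000000 in
/-- The resultant of `p₁` and `p₃` is `R₁ R₂` up to sign. -/
theorem resultant_p1_p3 (a : Fin 6 → ℝ) :
    Polynomial.resultant (p1 a).toPoly (p3 a).toPoly 3 3 = -(R1 a * R2 a) := by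
  have h (P Q : Cubic ℝ) : Polynomial.resultant P.toPoly Q.toPoly 3 3 =
      Matrix.det !![Q.d, 0, 0, P.d, 0, 0; Q.c, Q.d, 0, P.c, P.d, 0;
        Q.b, Q.c, Q.d, P.b, P.c, P.d; Q.a, Q.b, Q.c, P.a, P.b, P.c;
        0, Q.a, Q.b, 0, P.a, P.b; 0, 0, Q.a, 0, 0, P.a] := by
    unfold Polynomial.resultant
    congr 1
    ext i j
    fin_cases i <;> fin_cases j <;> simp [Polynomial.sylvester, Fin.addCases]
  rw [h]
  simp [Matrix.det_succ_row_zero, Fin.sum_univ_succ, Fin.succAbove]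
  simp only [p1, p2, p3, R1, R2]
  ring

/-- `R₁₁₃ = res(p₁', p₃)`. -/
noncomputable def R113 (a : Fin 6 → ℝ) : ℝ :=
  Polynomial.resultant (Polynomial.derivative (p1 a).toPoly) (p3 a).toPoly 2 3

/-- `R₁₃₃ = res(p₁, p₃')`. -/
noncomputable def R133 (a : Fin 6 → ℝ) : ℝ :=
  Polynomial.resultant (p1 a).toPoly (Polynomial.derivative (p3 a).toPoly) 3 2

/-- The remainder `r₁` of the division of `p₁` by `p₁'`. It agrees with the generic remainder,
whose denominators are powers of the leading coefficient of `p₁`, wherever `p₁` has degree three. -/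
noncomputable def r1 (a : Fin 6 → ℝ) : Polynomial ℝ :=
  (p1 a).toPoly % Polynomial.derivative (p1 a).toPoly

/-- The remainder `r₃` of the division of `p₃` by `p₃'`. It agrees with the generic remainder,
whose denominators are powers of the leading coefficient of `p₃`, wherever `p₃` has degree three. -/
noncomputable def r3 (a : Fin 6 → ℝ) : Polynomial ℝ :=
  (p3 a).toPoly % Polynomial.derivative (p3 a).toPoly

/-- `R̄₁₁₃ = res(r₁, p₃)`. -/
noncomputable def Rbar113 (a : Fin 6 → ℝ) : ℝ :=
  Polynomial.resultant (r1 a) (p3 a).toPoly 1 3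

/-- `R̄₁₃₃ = res(p₁, r₃)`. -/
noncomputable def Rbar133 (a : Fin 6 → ℝ) : ℝ :=
  Polynomial.resultant (p1 a).toPoly (r3 a) 3 1

/-- The semi-variety 1a). -/
def S1a : Set (Fin 6 → ℝ) :=
  {a | a 5 = 0 ∧ a 4 = 0 ∧ 3 * a 2 + a 3 = 0 ∧ a 1 = 0}

/-- The semi-variety 1b). -/
def S1b : Set (Fin 6 → ℝ) :=
  {a | a 0 * a 5 - a 1 = 0 ∧ a 0 * a 4 - a 2 + a 3 + a 5 = 0 ∧
    a 0 * (3 * a 2 + a 3) - 3 * a 1 - a 4 = 0 ∧ a 0 * a 1 + a 2 = 0}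

/-- The semi-variety 2). -/
def S2 : Set (Fin 6 → ℝ) :=
  {a | a 5 = 0 ∧ 3 * a 1 + a 4 = 0 ∧ (3 * a 2 + a 3) * a 1 ≠ 0 ∧ R2 a = 0 ∧
    a 1 ^ 2 ≤ 4 * a 2 ^ 2 + 4 * a 0 * a 1 * a 2}

/-- The common condition of 3): `p₃` has degree one and `p₁` has degree three. -/
def S3 : Set (Fin 6 → ℝ) :=
  {a | a 1 - a 0 * a 5 = 0 ∧ 2 * a 2 + a 3 + a 0 * (3 * a 1 + a 4) + a 5 = 0 ∧
    a 5 * (3 * a 1 - a 0 * (3 * a 2 + a 3) + a 4) ≠ 0}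

/-- The semi-variety 3a). -/
def S3a : Set (Fin 6 → ℝ) :=
  {a | a ∈ S3 ∧ R2 a = 0 ∧ D1 a ≤ 0 ∧ R113 a ≠ 0}

/-- The semi-variety 3b). -/
def S3b : Set (Fin 6 → ℝ) :=
  {a | a ∈ S3 ∧ 4 * a 3 - 9 * a 5 = 0 ∧ 4 * a 2 + 5 * a 5 = 0 ∧ 9 * a 1 + a 4 = 0 ∧
    9 * a 0 * a 5 + a 4 = 0 ∧ 8 * a 0 ^ 2 - 1 = 0}

/-- The semi-variety 4). -/
def S4 : Set (Fin 6 → ℝ) :=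
  {a | a 1 = 0 ∧ a 5 = 0 ∧ a 4 * (a 2 - a 0 * a 4) ≠ 0 ∧ 3 * a 2 + a 3 = 0 ∧
    4 * a 2 ^ 2 - 4 * a 0 * a 2 * a 4 ≥ a 4 ^ 2}

/-- The common condition of 5): `p₁` and `p₃` have degree three, and `R₂ = 0`. -/
def S5 : Set (Fin 6 → ℝ) :=
  {a | a 5 * (a 1 - a 0 * a 5) ≠ 0 ∧ R2 a = 0}

/-- The semi-variety 5a). -/
def S5a : Set (Fin 6 → ℝ) :=
  {a | a ∈ S5 ∧ D1 a < 0 ∧ D3 a < 0 ∧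
    (a 2 - a 5) * (a 1 ^ 2 + (a 3 + 2 * a 2) ^ 2) ≠ 0}

/-- The semi-variety 5b). -/
def S5b : Set (Fin 6 → ℝ) :=
  {a | a ∈ S5 ∧ D1 a = 0 ∧ D3 a < 0 ∧ D1' a * R113 a ≠ 0}

/-- The semi-variety 5c). -/
def S5c : Set (Fin 6 → ℝ) :=
  {a | a ∈ S5 ∧ D1 a = 0 ∧ D1' a = 0 ∧ D3 a < 0}

/-- The semi-variety 5d). -/
def S5d : Set (Fin 6 → ℝ) :=
  {a | a ∈ S5 ∧ D3 a = 0 ∧ D1 a < 0 ∧ D3' a * R133 a ≠ 0}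

/-- The semi-variety 5e). -/
def S5e : Set (Fin 6 → ℝ) :=
  {a | a ∈ S5 ∧ D3 a = 0 ∧ D3' a = 0 ∧ D1 a < 0}

/-- The semi-variety 5f). -/
def S5f : Set (Fin 6 → ℝ) :=
  {a | a ∈ S5 ∧ D1 a = 0 ∧ D3 a = 0 ∧ D1' a * D3' a * Rbar113 a * Rbar133 a ≠ 0}

/-- The semi-variety 5g). -/
def S5g : Set (Fin 6 → ℝ) :=
  {a | a ∈ S5 ∧ D1 a = 0 ∧ D1' a = 0 ∧ D3 a = 0 ∧ Rbar133 a ≠ 0}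

/-- The semi-variety 5h). -/
def S5h : Set (Fin 6 → ℝ) :=
  {a | a ∈ S5 ∧ D1 a = 0 ∧ D3 a = 0 ∧ D3' a = 0 ∧ Rbar113 a ≠ 0}

end QuadraticSystem

/-! Lower bounds on dimension come from charts. If `d` polynomial functions on `S` take all values
near some point of ℝᵈ, they are algebraically independent modulo the vanishing ideal, and Noether
normalization gives dimension at least `d` (`le_dimension_of_eventually`). Charts inside R₂ = 0 rest
on `R2_eq_zero_of_common_root`: a common real root t of p₁ and p₃ forces R₂ = 0, so one chooses t
and solves for the remaining parameters. D₁ = 0 or D₃ = 0 is arranged by giving the cubic a double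
root. Strict inequalities and non-vanishing conditions are open, so it suffices to check them at one
base point.

Upper bounds come from generators of the coordinate ring: equations solved for some parameters leave
few generators, and a nontrivial relation among these removes one more dimension. For the sets with
R₂ = 0 and a vanishing discriminant, R₂ is prime (`prime_R2Poly`), being a primitive quadratic in a₅
with non-square discriminant. It divides neither D₁ nor D₃, since each of these is nonzero at some
real zero of R₂; hence the dimension is at most 4 (`dimension_le_of_prime`).

The chart of `S5f` has three parameters, which leaves two possible codimensions. For `S5c`, `S5e`,
`S5g` and `S5h` an explicit point excludes dimension `⊥`. -/

namespace QuadraticSystem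

/-! ### Closed formulas for the resultants. -/

/-- The resultant of the linear polynomial `l₁ x + l₀` and a formal cubic. -/
def linearResultant (l1 l0 : ℝ) (Q : Cubic ℝ) : ℝ :=
  Q.d * l1 ^ 3 - Q.c * l1 ^ 2 * l0 + Q.b * l1 * l0 ^ 2 - Q.a * l0 ^ 3

/-- The resultant of the quadratic polynomial `q₂ x² + q₁ x + q₀` and a formal cubic. -/
def quadraticResultant (q2 q1 q0 : ℝ) (Q : Cubic ℝ) : ℝ :=
  3 * Q.d * q2 * q1 * Q.a * q0 + Q.d * q2 * q1 ^ 2 * Q.b - Q.d * q2 ^ 2 * q1 * Q.c -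
    2 * Q.d * q2 ^ 2 * Q.b * q0 - Q.d * q1 ^ 3 * Q.a + Q.d ^ 2 * q2 ^ 3 - q2 * q1 * Q.c * Q.b * q0 -
    2 * q2 * Q.c * Q.a * q0 ^ 2 + q2 * Q.b ^ 2 * q0 ^ 2 + q2 ^ 2 * Q.c ^ 2 * q0 -
    q1 * Q.b * Q.a * q0 ^ 2 + q1 ^ 2 * Q.c * Q.a * q0 + Q.a ^ 2 * q0 ^ 3

open Polynomial in
theorem resultant_linear_cubic (f : ℝ[X]) (Q : Cubic ℝ) :
    resultant f Q.toPoly 1 3 = linearResultant (f.coeff 1) (f.coeff 0) Q := by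
  have h : resultant f Q.toPoly 1 3 = Matrix.det !![Q.d, f.coeff 0, 0, 0;
      Q.c, f.coeff 1, f.coeff 0, 0; Q.b, 0, f.coeff 1, f.coeff 0; Q.a, 0, 0, f.coeff 1] := by
    unfold Polynomial.resultant
    congr 1
    ext i j
    fin_cases i <;> fin_cases j <;> simp [Polynomial.sylvester, Fin.addCases]
  rw [h, linearResultant]
  simp [Matrix.det_succ_row_zero, Fin.sum_univ_succ, Fin.succAbove]
  ring

open Polynomial in
theorem resultant_quadratic_cubic (f : ℝ[X]) (Q : Cubic ℝ) :
    resultant f Q.toPoly 2 3 = quadraticResultant (f.coeff 2) (f.coeff 1) (f.coeff 0) Q := by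
  have h : resultant f Q.toPoly 2 3 = Matrix.det !![Q.d, 0, f.coeff 0, 0, 0;
      Q.c, Q.d, f.coeff 1, f.coeff 0, 0; Q.b, Q.c, f.coeff 2, f.coeff 1, f.coeff 0;
      Q.a, Q.b, 0, f.coeff 2, f.coeff 1; 0, Q.a, 0, 0, f.coeff 2] := by
    unfold Polynomial.resultant
    congr 1
    ext i j
    fin_cases i <;> fin_cases j <;> simp [Polynomial.sylvester, Fin.addCases]
  rw [h, quadraticResultant]
  simp [Matrix.det_succ_row_zero, Fin.sum_univ_succ, Fin.succAbove]
  ring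

/-- The resultant of the derivative of a formal cubic `P` and a formal cubic `Q`. -/
def derivResultant (P Q : Cubic ℝ) : ℝ :=
  quadraticResultant (3 * P.a) (2 * P.b) P.c Q

theorem resultant_derivative (P Q : Cubic ℝ) :
    Polynomial.resultant (Polynomial.derivative P.toPoly) Q.toPoly 2 3 = derivResultant P Q := by
  rw [resultant_quadratic_cubic, derivResultant]
  congr 1 <;> simp [Polynomial.coeff_derivative] <;> ring

/-- The closed form is polynomial in the parameters, which gives continuity and numerical
evaluation. -/
theorem R113_eq (a : Fin 6 → ℝ) : R113 a = derivResultant (p1 a) (p3 a) :=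
  resultant_derivative _ _

theorem R133_eq (a : Fin 6 → ℝ) : R133 a = derivResultant (p3 a) (p1 a) := by
  rw [R133, Polynomial.resultant_comm, resultant_derivative]
  norm_num

/-- The resultant of `9 a` times the remainder of the division of a formal cubic
`P = a x³ + b x² + c x + d` by its derivative and a formal cubic `Q`. -/
def remainderResultant (P Q : Cubic ℝ) : ℝ :=
  linearResultant (6 * P.a * P.c - 2 * P.b ^ 2) (9 * P.a * P.d - P.b * P.c) Q

open Polynomial in
theorem mod_derivative (P : Cubic ℝ) (ha : P.a ≠ 0) :
    P.toPoly % derivative P.toPoly =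
      C ((6 * P.a * P.c - 2 * P.b ^ 2) / (9 * P.a)) * X +
        C ((9 * P.a * P.d - P.b * P.c) / (9 * P.a)) := by
  have hder : derivative P.toPoly = C (3 * P.a) * X ^ 2 + C (2 * P.b) * X + C P.c := by
    simp only [Cubic.toPoly, derivative_add, derivative_C_mul, derivative_X_pow, derivative_X,
      derivative_C, map_mul, map_ofNat, map_natCast]
    push_cast
    ring
  have hmod : (C ((6 * P.a * P.c - 2 * P.b ^ 2) / (9 * P.a)) * X +
        C ((9 * P.a * P.d - P.b * P.c) / (9 * P.a))) % derivative P.toPoly =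
      C ((6 * P.a * P.c - 2 * P.b ^ 2) / (9 * P.a)) * X +
        C ((9 * P.a * P.d - P.b * P.c) / (9 * P.a)) := by
    have hne : derivative P.toPoly ≠ 0 := by
      intro h
      have := congrArg (coeff · 2) (hder.symm.trans h)
      rw [coeff_add, coeff_add, coeff_C_mul, coeff_C_mul_X, coeff_X_pow, coeff_C] at this
      simp [ha] at this
    rw [mod_eq_self_iff hne, hder, degree_quadratic (by simpa using ha)]
    exact lt_of_le_of_lt degree_linear_le (by norm_num)
  have hP : P.toPoly = (C ((6 * P.a * P.c - 2 * P.b ^ 2) / (9 * P.a)) * X +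
        C ((9 * P.a * P.d - P.b * P.c) / (9 * P.a))) +
      derivative P.toPoly * (C (1 / 3) * X + C (P.b / (9 * P.a))) := by
    have e1 : P.b = 3 * P.a * (P.b / (9 * P.a)) + 2 * P.b * (1 / 3) := by field_simp; ring
    have e2 : P.c = (6 * P.a * P.c - 2 * P.b ^ 2) / (9 * P.a) + 2 * P.b * (P.b / (9 * P.a)) +
      P.c * (1 / 3) := by field_simp; ring
    have e3 : P.d = (9 * P.a * P.d - P.b * P.c) / (9 * P.a) + P.c * (P.b / (9 * P.a)) := by
      field_simp; ring
    have e0 : P.a = 3 * P.a * (1 / 3) := by ring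
    rw [hder]
    generalize (6 * P.a * P.c - 2 * P.b ^ 2) / (9 * P.a) = l1 at *
    generalize (9 * P.a * P.d - P.b * P.c) / (9 * P.a) = l0 at *
    generalize P.b / (9 * P.a) = k at *
    simp only [Cubic.toPoly]
    have f0 := congrArg (C : ℝ →+* ℝ[X]) e0
    have f1 := congrArg (C : ℝ →+* ℝ[X]) e1
    have f2 := congrArg (C : ℝ →+* ℝ[X]) e2
    have f3 := congrArg (C : ℝ →+* ℝ[X]) e3
    simp only [map_add, map_mul] at f0 f1 f2 f3 ⊢
    linear_combination X ^ 3 * f0 + X ^ 2 * f1 + X * f2 + f3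
  have hadd (r d q : ℝ[X]) : (r + d * q) % d = r % d := by
    rw [add_mod, EuclideanDomain.mod_eq_zero.mpr (dvd_mul_right d q), add_zero]
  exact ((congrArg (· % derivative P.toPoly) hP).trans (hadd _ _ _)).trans hmod

/-- The resultant is homogeneous of degree 3 in the coefficients of the linear remainder, whose
denominator is `9 * P.a`; the factor clears it, leaving an expression polynomial in the
coefficients. -/
theorem resultant_mod_derivative (P Q : Cubic ℝ) (ha : P.a ≠ 0) :
    (9 * P.a) ^ 3 * Polynomial.resultant (P.toPoly % Polynomial.derivative P.toPoly) Q.toPoly 1 3 =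
      remainderResultant P Q := by
  rw [mod_derivative P ha, resultant_linear_cubic, remainderResultant, linearResultant,
    linearResultant]
  simp
  field_simp

theorem Rbar113_ne_zero {a : Fin 6 → ℝ} (ha : (p1 a).a ≠ 0)
    (h : remainderResultant (p1 a) (p3 a) ≠ 0) : Rbar113 a ≠ 0 := by
  intro h0
  rw [Rbar113, r1] at h0
  rw [← resultant_mod_derivative _ _ ha, h0, mul_zero] at h
  exact h rfl

theorem Rbar133_ne_zero {a : Fin 6 → ℝ} (ha : (p3 a).a ≠ 0)
    (h : remainderResultant (p3 a) (p1 a) ≠ 0) : Rbar133 a ≠ 0 := by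
  intro h0
  rw [Rbar133, Polynomial.resultant_comm, r3] at h0
  rw [← resultant_mod_derivative _ _ ha] at h
  norm_num at h0
  rw [h0, mul_zero] at h
  exact h rfl

/-! ### Common roots and R₂. -/

/-- If `p₁` and `p₃` have a common real root, then `R₂ = 0`. -/
theorem R2_eq_zero_of_common_root {a : Fin 6 → ℝ} (t : ℝ)
    (h1 : (p1 a).a * t ^ 3 + (p1 a).b * t ^ 2 + (p1 a).c * t + (p1 a).d = 0)
    (h3 : (p3 a).a * t ^ 3 + (p3 a).b * t ^ 2 + (p3 a).c * t + (p3 a).d = 0) : R2 a = 0 := by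
  simp only [p1, p2, p3] at h1 h3
  simp only [R2]
  generalize a 0 = a1 at *
  generalize a 1 = a2 at *
  generalize a 2 = a3 at *
  generalize a 3 = a4 at *
  generalize a 4 = a5 at *
  generalize a 5 = a6 at *
  have ht : 1 + t ^ 2 ≠ 0 := by positivity
  -- Also p₂(t) = 0. Both p₁ + x p₂ and p₂ - x p₁ are divisible by 1 + x², and the quotients at t
  -- give the next two relations.
  have e0 : (2 * a3 + a4) * t = a2 * (t ^ 2 - 1) := by
    refine mul_left_cancel₀ ht ?_
    linear_combination (1 + t * a1) * h1 - t * h3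
  have e1 : (2 * a2 + a5) * t = a3 - a6 * t ^ 2 := by
    refine mul_left_cancel₀ ht ?_
    linear_combination -(t - a1) * h1 - h3
  -- The relations determine l₀ t and l₁ t, and hence t² R₂, which vanishes identically; t = 0
  -- instead forces a₂ = a₃ = 0.
  rcases eq_or_ne t 0 with rfl | h0
  · have h2 : a2 = 0 := by linear_combination e0
    have h3 : a3 = 0 := by linear_combination -e1
    rw [h2, h3]
    ring
  · refine mul_left_cancel₀ (pow_ne_zero 2 h0) ?_
    generalize 2 * a3 + a4 = l0 at *
    generalize 2 * a2 + a5 = l1 at *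
    linear_combination (a3 * a6 * (l0 * t + a2 * (t ^ 2 - 1)) + a2 * (l1 * t) * (a3 + a6)) * e0 +
      (a2 * (a2 * (t ^ 2 - 1)) * (a3 + a6) + a2 ^ 2 * (l1 * t + a3 - a6 * t ^ 2)) * e1

/-! ### Bounds for the dimension of a set. -/

open MvPolynomial Filter Topology

theorem aeval_aeval_eq_eval {n d : ℕ} (a : Fin n → ℝ) (f : Fin d → MvPolynomial (Fin n) ℝ)
    (p : MvPolynomial (Fin d) ℝ) :
    aeval a (aeval f p) = eval (fun j => eval a (f j)) p := by
  rw [← AlgHom.comp_apply, comp_aeval]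
  rfl

/-- The Krull dimension does not drop along injective integral ring homomorphisms. -/
theorem ringKrullDim_le_of_isIntegral {R S : Type*} [CommRing R] [CommRing S] [Algebra R S]
    [Algebra.IsIntegral R S] (hinj : Function.Injective (algebraMap R S)) :
    ringKrullDim R ≤ ringKrullDim S := by
  have : FaithfulSMul R S := (faithfulSMul_iff_algebraMap_injective R S).mpr hinj
  -- Lying over and going up lift every chain of primes to one of the same length.
  refine iSup_le fun l => ?_
  obtain ⟨⟨P, hP, hPl⟩⟩ := Ideal.nonempty_primesOver (S := S) l.head.asIdeal
  obtain ⟨l', hlen, -⟩ := Ideal.exists_ltSeries_of_hasGoingUp l P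
  rw [← hlen]
  exact Order.LTSeries.length_le_krullDim l'

/-- The number of algebraically independent elements of a finitely generated algebra over a field
is at most its Krull dimension. -/
theorem natCast_le_ringKrullDim_of_injective {k A : Type} [Field k] [CommRing A] [Algebra k A]
    [Algebra.FiniteType k A] {d : ℕ} (f : MvPolynomial (Fin d) k →ₐ[k] A)
    (hf : Function.Injective f) : (d : WithBot ℕ∞) ≤ ringKrullDim A := by
  -- Passing to a prime over zero makes the quotient a domain and keeps the `d` elements
  -- independent; transcendence degree then compares `d` with the number of variables in a Noether
  -- normalization.
  obtain ⟨Q, hQ, hQf⟩ := Ideal.exists_comap_eq_of_mem_minimalPrimes_of_injective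
    (f := (f : MvPolynomial (Fin d) k →+* A)) hf ⊥
    (by rw [IsDomain.minimalPrimes_eq_singleton_bot]; rfl)
  let g : MvPolynomial (Fin d) k →ₐ[k] A ⧸ Q := (Ideal.Quotient.mkₐ k Q).comp f
  have hg : Function.Injective g := by
    rw [injective_iff_map_eq_zero]
    intro p hp
    have hp' : f p ∈ Q := Ideal.Quotient.eq_zero_iff_mem.mp hp
    have : p ∈ Q.comap (f : MvPolynomial (Fin d) k →+* A) := hp'
    rwa [hQf] at this
  obtain ⟨s, h, hinj, hint⟩ := exists_integral_inj_algHom_of_fg k (A ⧸ Q)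
  algebraize [h.toRingHom]
  have : IsScalarTower k (MvPolynomial (Fin s) k) (A ⧸ Q) :=
    IsScalarTower.of_algebraMap_eq fun x => (h.commutes x).symm
  have : FaithfulSMul (MvPolynomial (Fin s) k) (A ⧸ Q) :=
    (faithfulSMul_iff_algebraMap_injective _ _).mpr hinj
  have : Algebra.IsIntegral (MvPolynomial (Fin s) k) (A ⧸ Q) := ⟨hint⟩
  have hds : d ≤ s := by
    have h1 := trdeg_add_eq k (MvPolynomial (Fin s) k) (A := A ⧸ Q)
    rw [trdeg_eq_zero (R := MvPolynomial (Fin s) k), add_zero,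
      MvPolynomial.trdeg_of_isDomain] at h1
    have h2 := trdeg_le_of_injective g hg
    rw [MvPolynomial.trdeg_of_isDomain, ← h1] at h2
    simpa using h2
  calc (d : WithBot ℕ∞) ≤ s := by exact_mod_cast hds
    _ = ringKrullDim (MvPolynomial (Fin s) k) := by simp
    _ ≤ ringKrullDim (A ⧸ Q) := ringKrullDim_le_of_isIntegral hinj
    _ ≤ ringKrullDim A := ringKrullDim_quotient_le Q

/-- A set whose image under `d` polynomial functions is a neighbourhood of a point of `ℝᵈ` has
dimension at least `d`. -/
theorem le_dimension_of_eventually {n d : ℕ} {S : Set (Fin n → ℝ)}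
    (f : Fin d → MvPolynomial (Fin n) ℝ) (x₀ : Fin d → ℝ)
    (h : ∀ᶠ x in nhds x₀, ∃ a ∈ S, ∀ i, eval a (f i) = x i) :
    (d : WithBot ℕ∞) ≤ dimension S := by
  refine natCast_le_ringKrullDim_of_injective
    ((Ideal.Quotient.mkₐ ℝ (vanishingIdeal ℝ S)).comp (aeval f)) ?_
  rw [injective_iff_map_eq_zero]
  intro p hp
  have hp' : aeval f p ∈ vanishingIdeal ℝ S := Ideal.Quotient.eq_zero_iff_mem.mp hp
  rw [Metric.eventually_nhds_iff_ball] at h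
  obtain ⟨ε, hε, h⟩ := h
  -- A polynomial vanishing on a product of infinite sets is zero.
  refine funext_set (fun i => Metric.ball (x₀ i) ε)
    (fun i => by rw [Real.ball_eq_Ioo]; exact Set.Ioo_infinite (by linarith)) fun x hx => ?_
  obtain ⟨a, ha, hax⟩ := h x (by rw [ball_pi _ hε]; exact hx)
  have := hp' a ha
  rwa [aeval_aeval_eq_eval, funext hax] at this

/-- If the coordinates of the points of `S` are polynomial functions of `d` polynomials, then these
polynomials generate the coordinate ring of `S`. -/
theorem surjective_mk_comp_aeval {n d : ℕ} {S : Set (Fin n → ℝ)}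
    (f : Fin d → MvPolynomial (Fin n) ℝ) (g : Fin n → MvPolynomial (Fin d) ℝ)
    (hfg : ∀ a ∈ S, ∀ i, eval (fun j => eval a (f j)) (g i) = a i) :
    Function.Surjective ((Ideal.Quotient.mkₐ ℝ (vanishingIdeal ℝ S)).comp (aeval f)) := by
  intro y
  obtain ⟨p, rfl⟩ := Ideal.Quotient.mkₐ_surjective ℝ _ y
  refine ⟨aeval g p, ?_⟩
  rw [AlgHom.comp_apply, Ideal.Quotient.mkₐ_eq_mk, Ideal.Quotient.eq, mem_vanishingIdeal_iff]
  intro a ha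
  have h : (aeval a : MvPolynomial (Fin n) ℝ →ₐ[ℝ] ℝ).comp ((aeval f).comp (aeval g)) =
      aeval a := by
    ext i
    rw [AlgHom.comp_apply, AlgHom.comp_apply, aeval_X, aeval_X, aeval_aeval_eq_eval]
    exact hfg a ha i
  rw [map_sub, sub_eq_zero]
  exact DFunLike.congr_fun h p

theorem dimension_le_of_generators {n d : ℕ} {S : Set (Fin n → ℝ)}
    (f : Fin d → MvPolynomial (Fin n) ℝ) (g : Fin n → MvPolynomial (Fin d) ℝ)
    (hfg : ∀ a ∈ S, ∀ i, eval (fun j => eval a (f j)) (g i) = a i) :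
    dimension S ≤ d := by
  simpa [dimension] using ringKrullDim_le_of_surjective _ (surjective_mk_comp_aeval f g hfg)

/-- The dimension of a set whose coordinate ring is generated by `d + 1` elements satisfying a
nontrivial relation is at most `d`. -/
theorem dimension_le_of_generators_of_relation {n d : ℕ} {S : Set (Fin n → ℝ)}
    (f : Fin (d + 1) → MvPolynomial (Fin n) ℝ) (g : Fin n → MvPolynomial (Fin (d + 1)) ℝ)
    (hfg : ∀ a ∈ S, ∀ i, eval (fun j => eval a (f j)) (g i) = a i)
    (h : MvPolynomial (Fin (d + 1)) ℝ) (h0 : h ≠ 0)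
    (hS : ∀ a ∈ S, eval (fun j => eval a (f j)) h = 0) :
    dimension S ≤ d := by
  have := ringKrullDim_succ_le_of_surjective _ (surjective_mk_comp_aeval f g hfg)
    (mem_nonZeroDivisors_of_ne_zero h0) (by
      refine Ideal.Quotient.eq_zero_iff_mem.mpr (mem_vanishingIdeal_iff.mpr fun a ha => ?_)
      exact (aeval_aeval_eq_eval a f h).trans (hS a ha))
  simp only [MvPolynomial.ringKrullDim_of_isNoetherianRing, ringKrullDim_eq_zero_of_field,
    zero_add, Nat.card_eq_fintype_card, Fintype.card_fin, Nat.cast_add, Nat.cast_one] at this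
  exact (ENat.WithBot.add_le_add_one_right_iff).mp this

/-- A set on which a prime polynomial and a polynomial not divisible by it vanish has codimension
at least two. -/
theorem dimension_le_of_prime {n : ℕ} {S : Set (Fin (n + 2) → ℝ)}
    {p q : MvPolynomial (Fin (n + 2)) ℝ} (hp : Prime p) (hq : ¬ p ∣ q)
    (hpS : ∀ a ∈ S, eval a p = 0) (hqS : ∀ a ∈ S, eval a q = 0) :
    dimension S ≤ n := by
  have : (Ideal.span {p}).IsPrime := (Ideal.span_singleton_prime hp.ne_zero).mpr hp
  have h1 := ringKrullDim_quotient_succ_le_of_nonZeroDivisor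
    (mem_nonZeroDivisors_of_ne_zero hp.ne_zero)
  have hle : Ideal.span {p} ≤ vanishingIdeal ℝ S := by
    rw [Ideal.span_singleton_le_iff_mem, mem_vanishingIdeal_iff]
    exact hpS
  -- Modulo the prime `p` the ring is a domain in which `q` is nonzero, so each of `p` and `q` costs
  -- one dimension.
  have h2 := ringKrullDim_succ_le_of_surjective (Ideal.Quotient.factor hle)
    (Ideal.Quotient.factor_surjective hle) (r := Ideal.Quotient.mk _ q)
    (mem_nonZeroDivisors_of_ne_zero (by
      rwa [Ne, Ideal.Quotient.eq_zero_iff_mem, Ideal.mem_span_singleton]))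
    (by
      rw [Ideal.Quotient.factor_mk, Ideal.Quotient.eq_zero_iff_mem, mem_vanishingIdeal_iff]
      exact hqS)
  have h3 : dimension S + 1 + 1 ≤ n + 1 + 1 := by
    refine (add_le_add_left h2 1).trans (h1.trans ?_)
    simp [add_assoc]; norm_num
  exact ENat.WithBot.add_le_add_one_right_iff.mp (ENat.WithBot.add_le_add_one_right_iff.mp h3)

theorem dimension_nonneg {n : ℕ} {S : Set (Fin n → ℝ)} (hS : S.Nonempty) : 0 ≤ dimension S := by
  obtain ⟨a, ha⟩ := hS
  have : Nontrivial (MvPolynomial (Fin n) ℝ ⧸ vanishingIdeal ℝ S) := by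
    rw [Ideal.Quotient.nontrivial_iff, Ne, Ideal.eq_top_iff_one, mem_vanishingIdeal_iff]
    intro h
    simpa using h a ha
  exact ringKrullDim_nonneg_of_nontrivial

theorem hasCodim_of_le_of_le {n c d : ℕ} {S : Set (Fin n → ℝ)} (h1 : dimension S ≤ d)
    (h2 : d ≤ dimension S) (h : d + c = n) : HasCodim S c := by
  rw [HasCodim, le_antisymm h1 h2, ← h]
  push_cast
  rfl

/-- The codimension of a nonempty set is a natural number. -/
theorem exists_hasCodim {n d : ℕ} {S : Set (Fin n → ℝ)} (h1 : dimension S ≤ (n - d : ℕ))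
    {e : ℕ} (h2 : e ≤ dimension S) (hd : d ≤ n) : ∃ c ≥ d, c ≤ n - e ∧ HasCodim S c := by
  obtain ⟨m, hm⟩ : ∃ m : ℕ, dimension S = m := by
    cases h : dimension S with
    | bot => rw [h] at h2; simp at h2
    | coe x =>
      cases x with
      | top =>
        rw [h] at h1
        exact absurd (WithBot.coe_le_coe.mp h1) (by simp)
      | coe m => exact ⟨m, rfl⟩
  rw [hm, Nat.cast_le] at h1 h2
  refine ⟨n - m, by omega, by omega, ?_⟩
  exact hasCodim_of_le_of_le (d := m) hm.le hm.ge (by omega)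

/-! ### Irreducibility of R₂. -/

/-- A primitive quadratic polynomial whose discriminant is not a square is irreducible. -/
theorem irreducible_quadratic {R : Type*} [CommRing R] [IsDomain R] {a b c : R} (ha : a ≠ 0)
    (hprim : ∀ d, d ∣ a → d ∣ b → d ∣ c → IsUnit d) (hdisc : ¬ IsSquare (discrim a b c)) :
    Irreducible (Polynomial.C a * Polynomial.X ^ 2 + Polynomial.C b * Polynomial.X +
      Polynomial.C c) := by
  set P := Polynomial.C a * Polynomial.X ^ 2 + Polynomial.C b * Polynomial.X + Polynomial.C c
    with hP
  have hdeg : P.natDegree = 2 := Polynomial.natDegree_quadratic ha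
  have hP0 : P ≠ 0 := by
    rintro h
    simp [h] at hdeg
  have coeffs (x y z : R) (Q : Polynomial R) (hQ : Q = Polynomial.C x * Polynomial.X ^ 2 +
      Polynomial.C y * Polynomial.X + Polynomial.C z) :
      Q.coeff 2 = x ∧ Q.coeff 1 = y ∧ Q.coeff 0 = z := by
    subst hQ
    simp [Polynomial.coeff_C]
  obtain ⟨c2, c1, c0⟩ := coeffs a b c P hP
  have key : ∀ f g : Polynomial R, P = f * g → f.natDegree = 0 → IsUnit f := by
    intro f g hfg hf
    obtain ⟨d, rfl⟩ := Polynomial.natDegree_eq_zero.mp hf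
    refine (hprim d ?_ ?_ ?_).map Polynomial.C
    · exact ⟨g.coeff 2, by rw [← c2, hfg, Polynomial.coeff_C_mul]⟩
    · exact ⟨g.coeff 1, by rw [← c1, hfg, Polynomial.coeff_C_mul]⟩
    · exact ⟨g.coeff 0, by rw [← c0, hfg, Polynomial.coeff_C_mul]⟩
  refine ⟨fun hu => ?_, fun f g hfg => ?_⟩
  · have := Polynomial.natDegree_eq_zero_of_isUnit hu
    omega
  have hf0 : f ≠ 0 := by rintro rfl; simp at hfg; exact hP0 hfg
  have hg0 : g ≠ 0 := by rintro rfl; simp at hfg; exact hP0 hfg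
  have hsum : f.natDegree + g.natDegree = 2 := by
    rw [← Polynomial.natDegree_mul hf0 hg0, ← hfg, hdeg]
  rcases Nat.eq_zero_or_pos f.natDegree with hf | hf
  · exact Or.inl (key f g hfg hf)
  rcases Nat.eq_zero_or_pos g.natDegree with hg | hg
  · exact Or.inr (key g f (by rw [hfg, mul_comm]) hg)
  exfalso
  have hf1 := Polynomial.eq_X_add_C_of_natDegree_le_one (p := f) (by omega)
  have hg1 := Polynomial.eq_X_add_C_of_natDegree_le_one (p := g) (by omega)
  generalize f.coeff 1 = f1 at hf1
  generalize f.coeff 0 = f0 at hf1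
  generalize g.coeff 1 = g1 at hg1
  generalize g.coeff 0 = g0 at hg1
  have hmul : P = Polynomial.C (f1 * g1) * Polynomial.X ^ 2 +
      Polynomial.C (f1 * g0 + f0 * g1) * Polynomial.X + Polynomial.C (f0 * g0) := by
    rw [hfg, hf1, hg1]
    simp only [map_mul, map_add]
    ring
  obtain ⟨e2, e1, e0⟩ := coeffs _ _ _ P hmul
  exact hdisc ⟨f1 * g0 - f0 * g1, by rw [discrim, ← c2, ← c1, ← c0, e2, e1, e0]; ring⟩

/-- If h² = X² + 4, then (h - X)(h + X) = 4 makes both factors constant, but they differ by 2X. -/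
theorem not_isSquare_X_sq_add_four : ¬ IsSquare (Polynomial.X ^ 2 + 4 : Polynomial ℝ) := by
  rintro ⟨h, hh⟩
  have h4 : IsUnit (4 : Polynomial ℝ) :=
    Polynomial.isUnit_C.mpr (isUnit_iff_ne_zero.mpr (by norm_num : (4 : ℝ) ≠ 0))
  have hmul : (h - Polynomial.X) * (h + Polynomial.X) = 4 := by
    linear_combination -hh
  have h1 := Polynomial.natDegree_eq_zero_of_isUnit (isUnit_of_mul_isUnit_left (hmul ▸ h4))
  have h2 := Polynomial.natDegree_eq_zero_of_isUnit (isUnit_of_mul_isUnit_right (hmul ▸ h4))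
  have h3 := Polynomial.natDegree_sub_le (h + Polynomial.X) (h - Polynomial.X)
  rw [h1, h2, show h + Polynomial.X - (h - Polynomial.X) = Polynomial.C 2 * Polynomial.X by
    simp only [map_ofNat]; ring, Polynomial.natDegree_C_mul_X _ two_ne_zero] at h3
  simp at h3

/-- The polynomial `R₂`. -/
noncomputable def R2Poly : MvPolynomial (Fin 6) ℝ :=
  X 2 * X 5 * (2 * X 2 + X 3) ^ 2 + X 1 * (2 * X 2 + X 3) * (2 * X 1 + X 4) * (X 2 + X 5) +
    X 1 ^ 2 * ((2 * X 1 + X 4) - (X 2 - X 5)) * ((2 * X 1 + X 4) + (X 2 - X 5))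

theorem eval_R2Poly (a : Fin 6 → ℝ) : eval a R2Poly = R2 a := by
  simp [R2Poly, R2]

/-- `ℝ[a₁, …, a₆]` as the ring of polynomials in `a₅` over the polynomials in the other
variables. -/
noncomputable def polynomialInA5 :
    MvPolynomial (Fin 6) ℝ ≃ₐ[ℝ] Polynomial (MvPolynomial (Fin 5) ℝ) :=
  (renameEquiv ℝ (Equiv.swap (0 : Fin 6) 4)).trans (finSuccEquiv ℝ 5)

theorem prime_R2Poly : Prime R2Poly := by
  rw [← UniqueFactorizationMonoid.irreducible_iff_prime,
    ← MulEquiv.irreducible_iff polynomialInA5]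
  -- The swap exchanges a₁ and a₅, so the five remaining variables `X 0`, …, `X 4` are a₂, a₃, a₄,
  -- a₁, a₆.
  let A : MvPolynomial (Fin 5) ℝ := X 0 ^ 2
  let B : MvPolynomial (Fin 5) ℝ := 4 * X 0 ^ 3 + X 0 * (2 * X 1 + X 2) * (X 1 + X 4)
  let C' : MvPolynomial (Fin 5) ℝ := X 1 * X 4 * (2 * X 1 + X 2) ^ 2 +
    2 * X 0 ^ 2 * (2 * X 1 + X 2) * (X 1 + X 4) + X 0 ^ 2 * (4 * X 0 ^ 2 - (X 1 - X 4) ^ 2)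
  have hx0 : polynomialInA5 (X 4) = Polynomial.X := by
    simp [polynomialInA5, finSuccEquiv_X_zero]
  have hx (i : Fin 5) (hi : i ≠ 3) : polynomialInA5 (X i.succ) = Polynomial.C (X i) := by
    have h1 : Equiv.swap (0 : Fin 6) 4 i.succ = i.succ :=
      Equiv.swap_apply_of_ne_of_ne (Fin.succ_ne_zero i) (fun h => hi (Fin.succ_injective _ h))
    simp [polynomialInA5, h1, finSuccEquiv_X_succ]
  have h1 := hx 0 (by decide)
  have h2 := hx 1 (by decide)
  have h3 := hx 2 (by decide)
  have h5 := hx 4 (by decide)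
  simp only [Fin.succ_zero_eq_one, Fin.succ_one_eq_two, Fin.reduceSucc] at h1 h2 h3 h5
  have hR : polynomialInA5 R2Poly = Polynomial.C A * Polynomial.X ^ 2 +
      Polynomial.C B * Polynomial.X + Polynomial.C C' := by
    simp only [R2Poly, map_add, map_mul, map_sub, map_pow, map_ofNat, hx0, h1, h2, h3, h5, A, B, C']
    ring
  rw [hR]
  refine irreducible_quadratic (pow_ne_zero _ (X_ne_zero _)) (fun d hd _ hd' => ?_) ?_
  -- A non-unit divisor of a₂² is divisible by a₂, but at a₂ = 0 the constant term is a₃ a₆ (2 a₃ +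
  -- a₄)², which is not zero.
  · obtain ⟨i, hi, hdi⟩ := (dvd_prime_pow (X_prime (i := (0 : Fin 5))) 2).mp hd
    rcases Nat.eq_zero_or_pos i with rfl | hi0
    · simpa [associated_one_iff_isUnit] using hdi
    · exfalso
      obtain ⟨e, he⟩ := (dvd_pow_self _ hi0.ne').trans (hdi.symm.dvd.trans hd')
      have := congrArg (eval ![0, 1, 0, 0, 1]) he
      simp [C'] at this
  · rintro ⟨h, hh⟩
    -- At a₂ = a₃ = 1, a₄ = X - 2, a₁ = a₆ = 0 the discriminant is (X + 4)² - 4 (2 X + 3) = X² + 4.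
    have := congrArg (aeval ![1, 1, Polynomial.X - 2, 0, 0] :
      MvPolynomial (Fin 5) ℝ →ₐ[ℝ] Polynomial ℝ) hh
    refine not_isSquare_X_sq_add_four ⟨_, Eq.trans ?_ (this.trans (map_mul _ _ _))⟩
    simp [discrim, A, B, C']
    ring

/-! ### Parametrizations and continuous choices of roots. -/

@[fun_prop]
theorem continuousAt_coordinate {d : ℕ} (i : Fin d) (x₀ : Fin d → ℝ) :
    ContinuousAt (fun x : Fin d → ℝ => x i) x₀ :=
  continuousAt_apply i x₀

/-- The parameters with `a₁ = a0` and `a₃ = u` for which `p₁ = v + c x - b x² - w x³`. -/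
def paramPoint (a0 v c b w u : ℝ) : Fin 6 → ℝ :=
  ![a0, v, u, c - 3 * u, b - 3 * v, w]

theorem p1_paramPoint (a0 v c b w u : ℝ) : p1 (paramPoint a0 v c b w u) = ⟨-w, -b, c, v⟩ := by
  simp [p1, paramPoint]

theorem p3_paramPoint (a0 v c b w u : ℝ) :
    p3 (paramPoint a0 v c b w u) =
      ⟨v - a0 * w, u - w - c - a0 * b, a0 * c - b, a0 * v + u⟩ := by
  simp only [p3, p2, p1_paramPoint]
  simp only [paramPoint, Cubic.mk.injEq]
  simp
  refine ⟨by ring, by ring⟩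

/-- The hypotheses say p₁(t) = 0 and p₂(t) = 0; the second is linear in a₃ = u with coefficient 1 +
t², so it can always be solved. -/
theorem R2_paramPoint_eq_zero {a0 v c b w u : ℝ} (t : ℝ) (h1 : v + c * t = b * t ^ 2 + w * t ^ 3)
    (h2 : u * (1 + t ^ 2) = b * t + (c + w) * t ^ 2 - v * t ^ 3) :
    R2 (paramPoint a0 v c b w u) = 0 := by
  apply R2_eq_zero_of_common_root t
  · rw [p1_paramPoint]
    linear_combination h1
  · rw [p3_paramPoint]
    linear_combination a0 * h1 + h2

theorem continuousAt_paramPoint {E : Type*} [TopologicalSpace E] {x₀ : E}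
    {a0 v c b w u : E → ℝ} (h0 : ContinuousAt a0 x₀) (hv : ContinuousAt v x₀)
    (hc : ContinuousAt c x₀) (hb : ContinuousAt b x₀) (hw : ContinuousAt w x₀)
    (hu : ContinuousAt u x₀) :
    ContinuousAt (fun x => paramPoint (a0 x) (v x) (c x) (b x) (w x) (u x)) x₀ := by
  rw [continuousAt_pi]
  intro i
  fin_cases i <;> simp [paramPoint] <;> fun_prop

/-- The cubic is a (x - t)(x - r)². -/
theorem discr_eq_zero_of_double_root (a t r : ℝ) :
    (⟨a, -(a * (t + 2 * r)), a * (r ^ 2 + 2 * r * t), -(a * r ^ 2 * t)⟩ : Cubic ℝ).discr = 0 := by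
  simp only [Cubic.discr]
  ring

theorem continuous_D1 : Continuous D1 := by
  unfold D1 Cubic.discr p1
  fun_prop

theorem continuous_D3 : Continuous D3 := by
  unfold D3 Cubic.discr p3 p2 p1
  fun_prop

theorem continuous_D1' : Continuous D1' := by
  unfold D1' derivDiscr discrim p1
  fun_prop

theorem continuous_D3' : Continuous D3' := by
  unfold D3' derivDiscr discrim p3 p2 p1
  fun_prop

theorem continuous_R113 : Continuous R113 := by
  simp only [funext R113_eq, derivResultant, quadraticResultant, p3, p2, p1]
  fun_prop

theorem continuous_R133 : Continuous R133 := by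
  simp only [funext R133_eq, derivResultant, quadraticResultant, p3, p2, p1]
  fun_prop

/-- Solutions `t > 0` of `t - 1 / t = k`. -/
theorem exists_continuousAt_sub_inv {E : Type*} [TopologicalSpace E] {x₀ : E} {k : E → ℝ}
    (hk : ContinuousAt k x₀) (hk0 : k x₀ = 0) :
    ∃ t : E → ℝ, ContinuousAt t x₀ ∧ t x₀ = 1 ∧ (∀ x, 0 < t x) ∧
      ∀ x, t x ^ 2 - 1 = k x * t x := by
  refine ⟨fun x => (k x + √(k x ^ 2 + 4)) / 2, by fun_prop, ?_, fun x => ?_, fun x => ?_⟩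
  · simp only [hk0]
    rw [show (0 : ℝ) ^ 2 + 4 = 2 ^ 2 by norm_num, Real.sqrt_sq (by norm_num)]
    norm_num
  · have : |k x| < √(k x ^ 2 + 4) := by
      rw [← Real.sqrt_sq_eq_abs]
      exact Real.sqrt_lt_sqrt (sq_nonneg _) (by linarith)
    linarith [neg_abs_le (k x)]
  · have := Real.sq_sqrt (show 0 ≤ k x ^ 2 + 4 by positivity)
    linear_combination this / 4

/-- Cubics with a double root `r` and a smaller simple root `t` in terms of their coefficients. -/
theorem exists_continuousAt_double_root {E : Type*} [TopologicalSpace E] {x₀ : E} {m n : E → ℝ}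
    (hm : ContinuousAt m x₀) (hn : ContinuousAt n x₀) (r₀ t₀ : ℝ) (hlt : t₀ < r₀)
    (hm0 : m x₀ = t₀ + 2 * r₀) (hn0 : n x₀ = r₀ ^ 2 + 2 * r₀ * t₀) :
    ∃ r t : E → ℝ, ContinuousAt r x₀ ∧ ContinuousAt t x₀ ∧ r x₀ = r₀ ∧ t x₀ = t₀ ∧
      ∀ᶠ x in 𝓝 x₀, t x + 2 * r x = m x ∧ r x ^ 2 + 2 * r x * t x = n x := by
  have hdisc : m x₀ ^ 2 - 3 * n x₀ = (r₀ - t₀) ^ 2 := by rw [hm0, hn0]; ring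
  have hr0 : (m x₀ + √(m x₀ ^ 2 - 3 * n x₀)) / 3 = r₀ := by
    rw [hdisc, Real.sqrt_sq (by linarith), hm0]
    ring
  -- For x³ - m x² + n x - r² t, a double root r above the simple root is the larger critical point.
  refine ⟨fun x => (m x + √(m x ^ 2 - 3 * n x)) / 3,
    fun x => m x - 2 * ((m x + √(m x ^ 2 - 3 * n x)) / 3), by fun_prop, by fun_prop, hr0, ?_, ?_⟩
  · simp only [hr0]
    rw [hm0]
    ring
  · have hpos : 0 < m x₀ ^ 2 - 3 * n x₀ := by
      rw [hdisc]
      exact pow_pos (by linarith) 2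
    have hc : ContinuousAt (fun x => m x ^ 2 - 3 * n x) x₀ := by fun_prop
    filter_upwards [hc.eventually_const_lt hpos] with x hx
    refine ⟨by ring, ?_⟩
    have := Real.sq_sqrt hx.le
    linear_combination -this / 3

/-- Variant of `le_dimension_of_eventually`, with a local section of the polynomial functions. -/
theorem le_dimension_of_chart {d : ℕ} {S : Set (Fin 6 → ℝ)}
    (f : Fin d → MvPolynomial (Fin 6) ℝ) (x₀ : Fin d → ℝ) (φ : (Fin d → ℝ) → Fin 6 → ℝ)
    (hS : ∀ᶠ x in 𝓝 x₀, φ x ∈ S)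
    (hf : ∀ᶠ x in 𝓝 x₀, ∀ i, eval (φ x) (f i) = x i) :
    (d : WithBot ℕ∞) ≤ dimension S :=
  le_dimension_of_eventually f x₀ (by filter_upwards [hS, hf] with x h1 h2 using ⟨φ x, h1, h2⟩)

theorem eventually_comp_ne_zero {E : Type*} [TopologicalSpace E] {x₀ : E} {φ : E → Fin 6 → ℝ}
    (hφ : ContinuousAt φ x₀) {F : (Fin 6 → ℝ) → ℝ} (hF : Continuous F) (h : F (φ x₀) ≠ 0) :
    ∀ᶠ x in 𝓝 x₀, F (φ x) ≠ 0 :=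
  (hF.continuousAt.comp hφ).eventually_ne h

theorem eventually_comp_neg {E : Type*} [TopologicalSpace E] {x₀ : E} {φ : E → Fin 6 → ℝ}
    (hφ : ContinuousAt φ x₀) {F : (Fin 6 → ℝ) → ℝ} (hF : Continuous F) (h : F (φ x₀) < 0) :
    ∀ᶠ x in 𝓝 x₀, F (φ x) < 0 :=
  (hF.continuousAt.comp hφ).eventually_lt_const h

theorem continuous_S5_condition : Continuous fun a : Fin 6 → ℝ => a 5 * (a 1 - a 0 * a 5) := by
  fun_prop

/-- The value of `a₃` for which a root `t` of `p₁` is a root of `p₂` as well. -/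
theorem exists_continuousAt_common_root {E : Type*} [TopologicalSpace E] {x₀ : E}
    {v c b w t : E → ℝ} (hv : ContinuousAt v x₀) (hc : ContinuousAt c x₀)
    (hb : ContinuousAt b x₀) (hw : ContinuousAt w x₀) (ht : ContinuousAt t x₀) :
    ∃ u : E → ℝ, ContinuousAt u x₀ ∧ ∀ x, u x * (1 + t x ^ 2) =
      b x * t x + (c x + w x) * t x ^ 2 - v x * t x ^ 3 := by
  have h (x) : 1 + t x ^ 2 ≠ 0 := by positivity
  exact ⟨fun x => (b x * t x + (c x + w x) * t x ^ 2 - v x * t x ^ 3) / (1 + t x ^ 2),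
    by fun_prop (disch := exact h _), fun x => div_mul_cancel₀ _ (h x)⟩

/-! ### Lower bounds: charts. -/

theorem le_dimension_S5b : ((4 : ℕ) : WithBot ℕ∞) ≤ dimension S5b := by
  -- The coordinates are a₁ and the three nonconstant coefficients of p₁, up to sign. The constant
  -- term makes p₁ = -a₆ (x - t)(x - r)², and a₃ makes t a root of p₂. At the base point p₁ = -x (x
  -- - 1)².
  let x₀ : Fin 4 → ℝ := ![-1, 1, -2, -1]
  have hx1 : x₀ 1 ≠ 0 := by simp [x₀]
  obtain ⟨r, t, hr, ht, hr0, ht0, hrt⟩ := exists_continuousAt_double_root (x₀ := x₀)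
    (m := fun x => -x 2 / x 1) (n := fun x => -x 3 / x 1)
    (by fun_prop (disch := assumption)) (by fun_prop (disch := assumption)) 1 0 one_pos
    (by simp [x₀]) (by simp [x₀])
  obtain ⟨u, hu, hut⟩ := exists_continuousAt_common_root (x₀ := x₀)
    (v := fun x => x 1 * r x ^ 2 * t x) (c := fun x => x 3) (b := fun x => x 2) (w := fun x => x 1)
    (t := t) (by fun_prop) (by fun_prop) (by fun_prop) (by fun_prop) ht
  have hu0 : u x₀ = 0 := by simpa [ht0] using hut x₀
  let φ : (Fin 4 → ℝ) → Fin 6 → ℝ := fun x =>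
    paramPoint (x 0) (x 1 * r x ^ 2 * t x) (x 3) (x 2) (x 1) (u x)
  have hφ : ContinuousAt φ x₀ :=
    continuousAt_paramPoint (by fun_prop) (by fun_prop) (by fun_prop) (by fun_prop) (by fun_prop) hu
  have hφ0 : φ x₀ = ![-1, 0, 0, -1, -2, 1] := by
    simp [φ, paramPoint, hr0, ht0, hu0, x₀]
  refine le_dimension_of_chart ![X 0, X 5, 3 * X 1 + X 4, 3 * X 2 + X 3] x₀ φ ?_ ?_
  · filter_upwards [hrt,
      (by fun_prop : ContinuousAt (fun x : Fin 4 → ℝ => x 1) x₀).eventually_ne hx1,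
      eventually_comp_ne_zero hφ continuous_S5_condition (by simp [hφ0]),
      eventually_comp_neg hφ continuous_D3
        (by simp [hφ0, D3, p3, p2, p1, Cubic.discr]; norm_num),
      eventually_comp_ne_zero hφ (continuous_D1'.mul continuous_R113)
        (by simp [hφ0, D1', derivDiscr, discrim, R113_eq, derivResultant, quadraticResultant,
          p3, p2, p1]; norm_num)] with x hrt hx1 e1 e2 e3
    obtain ⟨hm, hn⟩ := hrt
    have hb : x 2 = -(x 1 * (t x + 2 * r x)) := by rw [hm]; field_simp
    have hc : x 3 = -(x 1 * (r x ^ 2 + 2 * r x * t x)) := by rw [hn]; field_simp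
    refine ⟨⟨e1, R2_paramPoint_eq_zero (t x) ?_ (hut x)⟩, ?_, e2, e3⟩
    · rw [hb, hc]; ring
    · rw [D1, p1_paramPoint, ← discr_eq_zero_of_double_root (-x 1) (t x) (r x)]
      congr 2 <;> linarith
  · refine .of_forall fun x i => ?_
    fin_cases i <;> simp [φ, paramPoint]

theorem le_dimension_S5d : ((4 : ℕ) : WithBot ℕ∞) ≤ dimension S5d := by
  -- The coordinates are a₁ and the three nonconstant coefficients of p₃, which is x (x - 1)² at the
  -- base point.
  let x₀ : Fin 4 → ℝ := ![1, 1, -2, 1]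
  have hx1 : x₀ 1 ≠ 0 := by simp [x₀]
  obtain ⟨r, t, hr, ht, hr0, ht0, hrt⟩ := exists_continuousAt_double_root (x₀ := x₀)
    (m := fun x => -x 2 / x 1) (n := fun x => x 3 / x 1)
    (by fun_prop (disch := assumption)) (by fun_prop (disch := assumption)) 1 0 one_pos
    (by simp [x₀]) (by simp [x₀])
  have hta : (t x₀ - x₀ 0) * (1 + t x₀ ^ 2) ≠ 0 := by simp [ht0, x₀]
  have hpos (a : ℝ) : 1 + a ^ 2 ≠ 0 := by positivity
  -- Here c = 3 a₃ + a₄ + a₆ is determined by p₃ and a₁. The free parameter w = a₆ then adds the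
  -- multiple -w (x - a₁)(1 + x²) to p₁, so p₁(t) = 0 is linear in w.
  obtain ⟨c, hc, hc'⟩ : ∃ c : (Fin 4 → ℝ) → ℝ, ContinuousAt c x₀ ∧ ∀ x, c x * (1 + x 0 ^ 2) =
      x 0 * x 3 - x 1 * r x ^ 2 * t x - x 0 * x 1 - x 2 :=
    ⟨fun x => (x 0 * x 3 - x 1 * r x ^ 2 * t x - x 0 * x 1 - x 2) / (1 + x 0 ^ 2),
      by fun_prop (disch := exact hpos _), fun x => div_mul_cancel₀ _ (hpos _)⟩
  have hc0 : c x₀ = 1 := by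
    have := hc' x₀
    simp [ht0, x₀] at this
    linarith
  let w : (Fin 4 → ℝ) → ℝ := fun x =>
    (x 1 + c x * t x - (x 0 * c x - x 3) * t x ^ 2) / ((t x - x 0) * (1 + t x ^ 2))
  have hw : ContinuousAt w x₀ := by fun_prop (disch := assumption)
  have hw0 : w x₀ = -1 := by simp [w, ht0, x₀]
  let φ : (Fin 4 → ℝ) → Fin 6 → ℝ := fun x =>
    paramPoint (x 0) (x 1 + x 0 * w x) (c x - w x) (x 0 * (c x - w x) - x 3) (w x)
      (-(x 1 * r x ^ 2 * t x) - x 0 * (x 1 + x 0 * w x))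
  have hφ : ContinuousAt φ x₀ :=
    continuousAt_paramPoint (by fun_prop) (by fun_prop) (by fun_prop) (by fun_prop) (by fun_prop)
      (by fun_prop)
  have hφ0 : φ x₀ = ![1, 0, 0, 2, 1, -1] := by
    simp [φ, paramPoint, hr0, ht0, hc0, hw0, x₀]
    norm_num
  refine le_dimension_of_chart ![X 0, X 1 - X 0 * X 5,
    -X 0 * (3 * X 1 + X 4) - (2 * X 2 + X 3 + X 5), X 0 * (3 * X 2 + X 3) - (3 * X 1 + X 4)]
    x₀ φ ?_ ?_
  · filter_upwards [hrt,
      (by fun_prop : ContinuousAt (fun x : Fin 4 → ℝ => x 1) x₀).eventually_ne hx1,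
      (by fun_prop : ContinuousAt (fun x => (t x - x 0) * (1 + t x ^ 2)) x₀).eventually_ne hta,
      eventually_comp_ne_zero hφ continuous_S5_condition (by simp [hφ0]),
      eventually_comp_neg hφ continuous_D1
        (by simp [hφ0, D1, p1, Cubic.discr]; norm_num),
      eventually_comp_ne_zero hφ (continuous_D3'.mul continuous_R133)
        (by simp [hφ0, D3', derivDiscr, discrim, R133_eq, derivResultant, quadraticResultant,
          p3, p2, p1]; norm_num)] with x hrt hx1 hta e1 e2 e3
    obtain ⟨hm, hn⟩ := hrt
    have h2 : x 2 = -(x 1 * (t x + 2 * r x)) := by rw [hm]; field_simp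
    have h1 : x 3 = x 1 * (r x ^ 2 + 2 * r x * t x) := by rw [hn]; field_simp
    have hwx : w x * ((t x - x 0) * (1 + t x ^ 2)) =
        x 1 + c x * t x - (x 0 * c x - x 3) * t x ^ 2 := div_mul_cancel₀ _ hta
    have hp3 : p3 (φ x) = ⟨x 1, x 2, x 3, -(x 1 * r x ^ 2 * t x)⟩ := by
      simp only [φ, p3_paramPoint, Cubic.mk.injEq]
      refine ⟨by ring, ?_, by ring, by ring⟩
      linear_combination -hc' x
    refine ⟨⟨e1, R2_eq_zero_of_common_root (t x) ?_ ?_⟩, ?_, e2, e3⟩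
    · simp only [φ, p1_paramPoint]
      linear_combination -hwx
    · rw [hp3]
      linear_combination t x ^ 2 * h2 + t x * h1
    · rw [D3, hp3, ← discr_eq_zero_of_double_root (x 1) (t x) (r x), h1, h2]
  · refine .of_forall fun x i => ?_
    fin_cases i
    · simp [φ, paramPoint]
    · simp [φ, paramPoint]
    · simp [φ, paramPoint]
      linear_combination -hc' x
    · simp [φ, paramPoint]

theorem le_dimension_S5a : ((5 : ℕ) : WithBot ℕ∞) ≤ dimension S5a := by
  let x₀ : Fin 5 → ℝ := ![2, 1, 0, 0, 1]
  have hx1 : x₀ 1 ≠ 0 := by simp [x₀]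
  -- All parameters except a₅ are free: t solves (2 a₃ + a₄) t = a₂ (t² - 1), and a₅ is then read
  -- off from (2 a₂ + a₅) t = a₃ - a₆ t².
  obtain ⟨t, ht, ht0, htpos, htk⟩ := exists_continuousAt_sub_inv (x₀ := x₀)
    (k := fun x => (2 * x 2 + x 3) / x 1) (by fun_prop (disch := assumption)) (by simp [x₀])
  have ht1 : t x₀ ≠ 0 := (htpos _).ne'
  let φ : (Fin 5 → ℝ) → Fin 6 → ℝ := fun x =>
    paramPoint (x 0) (x 1) (3 * x 2 + x 3) (x 2 / t x - t x * x 4 + x 1) (x 4) (x 2)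
  have hφ : ContinuousAt φ x₀ :=
    continuousAt_paramPoint (by fun_prop) (by fun_prop) (by fun_prop)
      (by fun_prop (disch := assumption)) (by fun_prop) (by fun_prop)
  have hφ0 : φ x₀ = ![2, 1, 0, 0, -3, 1] := by
    simp [φ, paramPoint, ht0, x₀]
  refine le_dimension_of_chart ![X 0, X 1, X 2, X 3, X 5] x₀ φ ?_ ?_
  · filter_upwards [(by fun_prop : ContinuousAt (fun x : Fin 5 → ℝ => x 1) x₀).eventually_ne hx1,
      eventually_comp_ne_zero hφ continuous_S5_condition (by simp [hφ0]; norm_num),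
      eventually_comp_neg hφ continuous_D1 (by simp [hφ0, D1, p1, Cubic.discr]),
      eventually_comp_neg hφ continuous_D3
        (by simp [hφ0, D3, p3, p2, p1, Cubic.discr]; norm_num),
      eventually_comp_ne_zero hφ (F := fun a => (a 2 - a 5) * (a 1 ^ 2 + (a 3 + 2 * a 2) ^ 2))
        (by fun_prop) (by simp [hφ0])] with x hx1 e1 e2 e3 e4
    have hk : 2 * x 2 + x 3 = (2 * x 2 + x 3) / x 1 * x 1 := (div_mul_cancel₀ _ hx1).symm
    have htx := htk x
    have htx0 := (htpos x).ne'
    have hu : x 2 / t x * t x = x 2 := div_mul_cancel₀ _ htx0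
    refine ⟨⟨e1, R2_paramPoint_eq_zero (t x) ?_ ?_⟩, e2, e3, e4⟩
    · linear_combination t x * hk - x 1 * htx - t x * hu
    · linear_combination - hu - t x ^ 2 * hk + t x * x 1 * htx
  · refine .of_forall fun x i => ?_
    fin_cases i <;> simp [φ, paramPoint]

theorem le_dimension_S3a : ((3 : ℕ) : WithBot ℕ∞) ≤ dimension S3a := by
  let x₀ : Fin 3 → ℝ := ![2, 1, -1 / 2]
  have hx0 : x₀ 0 ≠ 0 := by simp [x₀]
  have hx1 : x₀ 1 ≠ 0 := by simp [x₀]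
  -- The top two coefficients of p₃ vanish when a₂ = a₁ a₆ and 2 a₃ + a₄ = -(a₆ + a₁ (3 a₂ + a₅)),
  -- so (2 a₃ + a₄) t = a₂ (t² - 1) becomes this equation; p₁(t) = 0 then gives c = 3 a₃ + a₄.
  obtain ⟨t, ht, ht0, htpos, htk⟩ := exists_continuousAt_sub_inv (x₀ := x₀)
    (k := fun x => -(x 2 / x 1 + 1 / x 0)) (by fun_prop (disch := assumption))
    (by simp [x₀]; norm_num)
  have ht1 : t x₀ ≠ 0 := (htpos _).ne'
  let c : (Fin 3 → ℝ) → ℝ := fun x => x 2 * t x + x 1 * t x ^ 2 - x 0 * x 1 / t x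
  have hc : ContinuousAt c x₀ := by fun_prop (disch := assumption)
  let φ : (Fin 3 → ℝ) → Fin 6 → ℝ := fun x =>
    paramPoint (x 0) (x 0 * x 1) (c x) (x 2) (x 1) (c x + x 1 + x 0 * x 2)
  have hφ : ContinuousAt φ x₀ :=
    continuousAt_paramPoint (by fun_prop) (by fun_prop) hc (by fun_prop) (by fun_prop)
      (by fun_prop)
  have hφ0 : φ x₀ = ![2, 2, -3 / 2, 3, -13 / 2, 1] := by
    simp [φ, c, paramPoint, ht0, x₀]
    norm_num
  refine le_dimension_of_chart ![X 0, X 5, 3 * X 1 + X 4] x₀ φ ?_ ?_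
  · filter_upwards [(by fun_prop : ContinuousAt (fun x : Fin 3 → ℝ => x 0) x₀).eventually_ne hx0,
      (by fun_prop : ContinuousAt (fun x : Fin 3 → ℝ => x 1) x₀).eventually_ne hx1,
      eventually_comp_neg hφ continuous_D1 (by simp [hφ0, D1, p1, Cubic.discr]; norm_num),
      eventually_comp_ne_zero hφ continuous_R113
        (by simp [hφ0, R113_eq, derivResultant, quadraticResultant, p3, p2, p1]; norm_num),
      eventually_comp_ne_zero hφ
        (F := fun a => a 5 * (3 * a 1 - a 0 * (3 * a 2 + a 3) + a 4))
        (by fun_prop) (by simp [hφ0]; norm_num)] with x hx0 hx1 e1 e2 e3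
    have htx0 := (htpos x).ne'
    have hcx : c x * t x = x 2 * t x ^ 2 + x 1 * t x ^ 3 - x 0 * x 1 := by
      simp only [c]
      field_simp
    have htx : x 0 * x 1 * (t x ^ 2 - 1) = -(x 0 * x 2 + x 1) * t x := by
      rw [htk]
      field_simp
    refine ⟨⟨?_, ?_, e3⟩, R2_paramPoint_eq_zero (t x) ?_ ?_, e1.le, e2⟩
    · simp [φ, paramPoint]
    · simp [φ, paramPoint]
      ring
    · linear_combination hcx
    · refine mul_left_cancel₀ htx0 ?_
      linear_combination hcx + (1 + t x ^ 2) * htx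
  · refine .of_forall fun x i => ?_
    fin_cases i <;> simp [φ, paramPoint]

theorem le_dimension_S2 : ((3 : ℕ) : WithBot ℕ∞) ≤ dimension S2 := by
  let x₀ : Fin 3 → ℝ := ![1, 1, 1]
  -- For a₆ = 0 and a₅ = -3 a₂, R₂ = a₂² (a₂² - a₃ (3 a₃ + a₄)), which is solved for a₄.
  let φ : (Fin 3 → ℝ) → Fin 6 → ℝ := fun x =>
    ![x 0, x 1, x 2, x 1 ^ 2 / x 2 - 3 * x 2, -(3 * x 1), 0]
  have h1 : ContinuousAt (fun x : Fin 3 → ℝ => x 1) x₀ := by fun_prop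
  have h2 : ContinuousAt (fun x : Fin 3 → ℝ => x 2) x₀ := by fun_prop
  have h3 : ContinuousAt
    (fun x : Fin 3 → ℝ => x 1 ^ 2 - (4 * x 2 ^ 2 + 4 * x 0 * x 1 * x 2)) x₀ := by fun_prop
  refine le_dimension_of_chart ![X 0, X 1, X 2] x₀ φ ?_ ?_
  · filter_upwards [h1.eventually_ne (y := 0) (by simp [x₀]),
      h2.eventually_ne (y := 0) (by simp [x₀]),
      h3.eventually_lt_const (u := 0) (by simp [x₀]; norm_num)] with x h1 h2 h3
    refine ⟨by simp [φ], by simp [φ], by simp [φ, h1, h2], ?_, by simp [φ]; linarith⟩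
    simp [φ, R2]
    field_simp
    ring
  · refine .of_forall fun x i => ?_
    fin_cases i <;> simp [φ]

theorem le_dimension_S4 : ((3 : ℕ) : WithBot ℕ∞) ≤ dimension S4 := by
  let x₀ : Fin 3 → ℝ := ![0, 1, 1]
  let φ : (Fin 3 → ℝ) → Fin 6 → ℝ := fun x => ![x 0, 0, x 1, -(3 * x 1), x 2, 0]
  have h1 : ContinuousAt (fun x : Fin 3 → ℝ => x 2 * (x 1 - x 0 * x 2)) x₀ := by fun_prop
  have h2 : ContinuousAt
    (fun x : Fin 3 → ℝ => x 2 ^ 2 - (4 * x 1 ^ 2 - 4 * x 0 * x 1 * x 2)) x₀ := by fun_prop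
  refine le_dimension_of_chart ![X 0, X 2, X 4] x₀ φ ?_ ?_
  · filter_upwards [h1.eventually_ne (y := 0) (by simp [x₀]),
      h2.eventually_lt_const (u := 0) (by simp [x₀])] with x h1 h2
    refine ⟨by simp [φ], by simp [φ], by simpa [φ] using h1, by simp [φ], ?_⟩
    simp [φ]
    linarith
  · refine .of_forall fun x i => ?_
    fin_cases i <;> simp [φ]

theorem le_dimension_S1a : ((2 : ℕ) : WithBot ℕ∞) ≤ dimension S1a := by
  refine le_dimension_of_chart ![X 0, X 2] 0 (fun x => ![x 0, 0, x 1, -(3 * x 1), 0, 0])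
    (.of_forall fun x => by simp [S1a]) (.of_forall fun x i => ?_)
  fin_cases i <;> simp

theorem le_dimension_S1b : ((2 : ℕ) : WithBot ℕ∞) ≤ dimension S1b := by
  refine le_dimension_of_chart ![X 0, X 5] 0 (fun x => ![x 0, x 0 * x 1, -(x 0 ^ 2 * x 1),
    x 1 * (3 * x 0 ^ 2 - 1), -(4 * x 0 * x 1), x 1]) (.of_forall fun x => ?_)
    (.of_forall fun x i => ?_)
  · simp [S1b]
    refine ⟨by ring, by ring, by ring⟩
  · fin_cases i <;> simp

theorem le_dimension_S3b : ((1 : ℕ) : WithBot ℕ∞) ≤ dimension S3b := by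
  obtain ⟨s, hs⟩ : ∃ s : ℝ, 8 * s ^ 2 = 1 :=
    ⟨√(1 / 8), by rw [Real.sq_sqrt (by norm_num)]; norm_num⟩
  have hs0 : s ≠ 0 := by
    rintro rfl
    norm_num at hs
  let x₀ : Fin 1 → ℝ := ![1]
  have h1 : ContinuousAt (fun x : Fin 1 → ℝ => x 0) x₀ := by fun_prop
  refine le_dimension_of_chart ![X 5] x₀ (fun x =>
    ![s, s * x 0, -(5 / 4 * x 0), 9 / 4 * x 0, -(9 * s * x 0), x 0]) ?_ (.of_forall fun x i => ?_)
  · filter_upwards [h1.eventually_ne (y := 0) (by simp [x₀])] with x hx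
    simp [S3b, S3]
    refine ⟨⟨?_, hx, ?_⟩, by ring, by ring, by ring, by linarith⟩
    · linear_combination (-3 / 4 * x 0) * hs
    · ring_nf
      simp [hs0, hx]
  · fin_cases i
    simp

/-- A family of cubics `p₁` and `p₃` with a common simple root `t` and double roots `r` and `q`. -/
theorem p3_eq_of_double_roots {a0 w r t q u : ℝ} (hd : r + q + 2 * t ≠ 0)
    (hq : q * (1 - r ^ 2 - 2 * r ^ 3 * t) = 2 * r ^ 2 * t + 3 * r + r ^ 3)
    (ha : a0 * ((r - q) * (r + q + 2 * t)) = t + 2 * r - r ^ 2 * t * (q ^ 2 + 2 * q * t))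
    (hu : u * (1 + t ^ 2) = -(w * (t + 2 * r)) * t + (-(w * (r ^ 2 + 2 * r * t)) + w) * t ^ 2 -
      w * r ^ 2 * t * t ^ 3) :
    p3 (paramPoint a0 (w * r ^ 2 * t) (-(w * (r ^ 2 + 2 * r * t))) (-(w * (t + 2 * r))) w u) =
      ⟨w * (r ^ 2 * t - a0), -(w * (r ^ 2 * t - a0) * (t + 2 * q)),
        w * (r ^ 2 * t - a0) * (q ^ 2 + 2 * q * t), -(w * (r ^ 2 * t - a0) * q ^ 2 * t)⟩ := by
  -- `ha` and `ha'` compare the linear and quadratic coefficients. Both are linear in `a0`;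
  -- eliminating `a0` leaves (1 + t²) times `hq`, which is linear in `q`.
  have ha' : a0 * ((r - q) * ((r + q) * t - 2)) =
      r ^ 2 + 2 * r * t - 1 - r ^ 2 * t * (q ^ 2 * t - t - 2 * q) := by
    refine mul_left_cancel₀ hd ?_
    linear_combination ((r + q) * t - 2) * ha + (1 + t ^ 2) * hq
  have hu' : u = -(w * (r ^ 2 * t - a0) * q ^ 2 * t) - a0 * (w * r ^ 2 * t) := by
    refine mul_left_cancel₀ (by positivity : 1 + t ^ 2 ≠ 0) ?_
    linear_combination hu + w * t ^ 2 * ha' + w * t * ha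
  simp only [p3_paramPoint, Cubic.mk.injEq]
  refine ⟨by ring, ?_, ?_, ?_⟩
  · rw [hu']
    linear_combination -w * ha'
  · linear_combination -w * ha
  · rw [hu']
    ring

theorem le_dimension_S5f : ((3 : ℕ) : WithBot ℕ∞) ≤ dimension S5f := by
  -- At the base point p₁ = -x (x - 1/2)², and `hq` and `ha` give q = 13/6 and a₁ = -9/40.
  let x₀ : Fin 3 → ℝ := ![1, -1, -1 / 4]
  have hx1 : x₀ 0 ≠ 0 := by simp [x₀]
  obtain ⟨r, t, hr, ht, hr0, ht0, hrt⟩ := exists_continuousAt_double_root (x₀ := x₀)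
    (m := fun x => -x 1 / x 0) (n := fun x => -x 2 / x 0)
    (by fun_prop (disch := assumption)) (by fun_prop (disch := assumption)) (1 / 2) 0 (by norm_num)
    (by simp [x₀]) (by simp [x₀]; norm_num)
  have hd1 : 1 - r x₀ ^ 2 - 2 * r x₀ ^ 3 * t x₀ ≠ 0 := by
    simp only [hr0, ht0]
    norm_num
  obtain ⟨q, hq, hq0, hqx⟩ : ∃ q : (Fin 3 → ℝ) → ℝ, ContinuousAt q x₀ ∧ q x₀ = 13 / 6 ∧
      ∀ x, 1 - r x ^ 2 - 2 * r x ^ 3 * t x ≠ 0 → q x * (1 - r x ^ 2 - 2 * r x ^ 3 * t x) =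
        2 * r x ^ 2 * t x + 3 * r x + r x ^ 3 := by
    refine ⟨fun x => (2 * r x ^ 2 * t x + 3 * r x + r x ^ 3) / (1 - r x ^ 2 - 2 * r x ^ 3 * t x),
      by fun_prop (disch := assumption), ?_, fun x h => div_mul_cancel₀ _ h⟩
    simp only [hr0, ht0]
    norm_num
  have hd2 : r x₀ + q x₀ + 2 * t x₀ ≠ 0 := by
    simp only [hr0, ht0, hq0]
    norm_num
  have hd3 : r x₀ - q x₀ ≠ 0 := by
    simp only [hr0, hq0]
    norm_num
  obtain ⟨a0, ha0, ha00, hax⟩ : ∃ a0 : (Fin 3 → ℝ) → ℝ, ContinuousAt a0 x₀ ∧ a0 x₀ = -9 / 40 ∧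
      ∀ x, (r x - q x) * (r x + q x + 2 * t x) ≠ 0 →
        a0 x * ((r x - q x) * (r x + q x + 2 * t x)) =
          t x + 2 * r x - r x ^ 2 * t x * (q x ^ 2 + 2 * q x * t x) := by
    refine ⟨fun x => (t x + 2 * r x - r x ^ 2 * t x * (q x ^ 2 + 2 * q x * t x)) /
      ((r x - q x) * (r x + q x + 2 * t x)), by fun_prop (disch := exact mul_ne_zero hd3 hd2), ?_,
      fun x h => div_mul_cancel₀ _ h⟩
    simp only [hr0, ht0, hq0]
    norm_num
  obtain ⟨u, hu, hut⟩ := exists_continuousAt_common_root (x₀ := x₀)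
    (v := fun x => x 0 * r x ^ 2 * t x) (c := fun x => x 2) (b := fun x => x 1) (w := fun x => x 0)
    (t := t) (by fun_prop) (by fun_prop) (by fun_prop) (by fun_prop) ht
  have hu0 : u x₀ = 0 := by simpa [ht0] using hut x₀
  let φ : (Fin 3 → ℝ) → Fin 6 → ℝ := fun x =>
    paramPoint (a0 x) (x 0 * r x ^ 2 * t x) (x 2) (x 1) (x 0) (u x)
  have hφ : ContinuousAt φ x₀ :=
    continuousAt_paramPoint (by fun_prop) (by fun_prop) (by fun_prop) (by fun_prop) (by fun_prop) hu
  have hφ0 : φ x₀ = ![-9 / 40, 0, 0, -1 / 4, -1, 1] := by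
    simp [φ, paramPoint, hr0, ht0, hu0, ha00, x₀]
  have hrem13 : Continuous fun a => remainderResultant (p1 a) (p3 a) := by
    unfold remainderResultant linearResultant p3 p2 p1
    fun_prop
  have hrem31 : Continuous fun a => remainderResultant (p3 a) (p1 a) := by
    unfold remainderResultant linearResultant p3 p2 p1
    fun_prop
  refine le_dimension_of_chart ![X 5, 3 * X 1 + X 4, 3 * X 2 + X 3] x₀ φ ?_ ?_
  · filter_upwards [hrt,
      (by fun_prop : ContinuousAt (fun x : Fin 3 → ℝ => x 0) x₀).eventually_ne hx1,
      (by fun_prop : ContinuousAt (fun x => 1 - r x ^ 2 - 2 * r x ^ 3 * t x) x₀).eventually_ne hd1,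
      (by fun_prop : ContinuousAt (fun x => r x + q x + 2 * t x) x₀).eventually_ne hd2,
      (by fun_prop : ContinuousAt (fun x => r x - q x) x₀).eventually_ne hd3,
      eventually_comp_ne_zero hφ continuous_S5_condition (by simp [hφ0]),
      eventually_comp_ne_zero hφ (continuous_D1'.mul continuous_D3')
        (by simp [hφ0, D1', D3', derivDiscr, discrim, p3, p2, p1]; norm_num),
      eventually_comp_ne_zero hφ hrem13
        (by simp [hφ0, remainderResultant, linearResultant, p3, p2, p1]; norm_num),
      eventually_comp_ne_zero hφ hrem31
        (by simp [hφ0, remainderResultant, linearResultant, p3, p2, p1]; norm_num)]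
      with x hrt hx1 hd1 hd2 hd3 e1 e2 e3 e4
    obtain ⟨hm, hn⟩ := hrt
    have hb : x 1 = -(x 0 * (t x + 2 * r x)) := by rw [hm]; field_simp
    have hc : x 2 = -(x 0 * (r x ^ 2 + 2 * r x * t x)) := by rw [hn]; field_simp
    have hux := hut x
    rw [hb, hc] at hux
    have hp3 := p3_eq_of_double_roots hd2 (hqx x hd1) (hax x (mul_ne_zero hd3 hd2)) hux
    rw [← hb, ← hc] at hp3
    refine ⟨⟨e1, R2_paramPoint_eq_zero (t x) ?_ (hut x)⟩, ?_, ?_, ?_⟩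
    · rw [hb, hc]; ring
    · rw [D1, p1_paramPoint, ← discr_eq_zero_of_double_root (-x 0) (t x) (r x)]
      congr 2 <;> linarith
    · rw [D3, hp3, discr_eq_zero_of_double_root]
    · refine mul_ne_zero (mul_ne_zero e2 (Rbar113_ne_zero ?_ e3)) (Rbar133_ne_zero ?_ e4)
      · simpa [φ, p1_paramPoint] using hx1
      · have := right_ne_zero_of_mul e1
        simp only [φ, p3_paramPoint]
        simpa [φ, paramPoint] using this
  · refine .of_forall fun x i => ?_
    fin_cases i <;> simp [φ, paramPoint]

/-! ### Explicit points. -/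

theorem nonempty_S5c : S5c.Nonempty := by
  -- p₁ = -(x - 1)³ and p₃ = (x - 1)(x² + 3).
  refine ⟨![0, 1, -3, 6, -6, 1], ⟨by simp, ?_⟩, ?_, ?_, ?_⟩ <;>
    simp [R2, D1, D1', D3, Cubic.discr, derivDiscr, discrim, p3, p2, p1] <;> norm_num

theorem nonempty_S5e : S5e.Nonempty := by
  -- p₃ = (x - 1)³ and p₁ = -(x - 1)(3 x² + 1).
  refine ⟨![0, 1, -1, 2, -6, 3], ⟨by simp, ?_⟩, ?_, ?_, ?_⟩ <;>
    simp [R2, D1, D3', D3, Cubic.discr, derivDiscr, discrim, p3, p2, p1] <;> norm_num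

theorem nonempty_S5g : S5g.Nonempty := by
  -- The previous p₁ = -(x - 1)³ and its p₂, with a₁ = 3/4 chosen so that p₃ = (x - 1)(x + 3)²/4.
  refine ⟨![3 / 4, 1, -3, 6, -6, 1], ⟨by simp; norm_num, ?_⟩, ?_, ?_, ?_, Rbar133_ne_zero ?_ ?_⟩ <;>
    simp [R2, D1, D1', D3, Cubic.discr, derivDiscr, discrim, remainderResultant, linearResultant,
      p3, p2, p1] <;> norm_num

theorem nonempty_S5h : S5h.Nonempty := by
  -- p₃ = (2/9)(x - 2)³ and p₁ = -(x - 2)(x - 1/3)².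
  refine ⟨![0, 2 / 9, -16 / 9, 35 / 9, -10 / 3, 1], ⟨by simp, ?_⟩, ?_, ?_, ?_,
    Rbar113_ne_zero ?_ ?_⟩ <;>
    simp [R2, D1, D3', D3, Cubic.discr, derivDiscr, discrim, remainderResultant, linearResultant,
      p3, p2, p1] <;> norm_num

/-! ### Upper bounds. -/

/-- The discriminant `D₁` as a polynomial in the parameters. -/
noncomputable def D1Poly : MvPolynomial (Fin 6) ℝ :=
  (⟨-X 5, -(3 * X 1 + X 4), 3 * X 2 + X 3, X 1⟩ : Cubic (MvPolynomial (Fin 6) ℝ)).discr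

theorem eval_D1Poly (a : Fin 6 → ℝ) : eval a D1Poly = D1 a := by
  simp [D1Poly, D1, Cubic.discr, p1]

/-- The discriminant `D₃` as a polynomial in the parameters. -/
noncomputable def D3Poly : MvPolynomial (Fin 6) ℝ :=
  (⟨X 0 * -X 5 - -X 1, X 0 * -(3 * X 1 + X 4) - (2 * X 2 + X 3 + X 5),
    X 0 * (3 * X 2 + X 3) - (3 * X 1 + X 4), X 0 * X 1 - -X 2⟩ :
    Cubic (MvPolynomial (Fin 6) ℝ)).discr

theorem eval_D3Poly (a : Fin 6 → ℝ) : eval a D3Poly = D3 a := by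
  simp [D3Poly, D3, Cubic.discr, p3, p2, p1]

theorem not_R2Poly_dvd {p : MvPolynomial (Fin 6) ℝ} {a : Fin 6 → ℝ} (h : R2 a = 0)
    (hp : eval a p ≠ 0) : ¬ R2Poly ∣ p := by
  rintro ⟨q, rfl⟩
  rw [map_mul, eval_R2Poly, h, zero_mul] at hp
  exact hp rfl

theorem dimension_le_of_D1_eq_zero {S : Set (Fin 6 → ℝ)} (h2 : ∀ a ∈ S, R2 a = 0)
    (h : ∀ a ∈ S, D1 a = 0) : dimension S ≤ (4 : ℕ) := by
  -- At this point R₂ = 0 but D₁ < 0, so R₂ does not divide D₁.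
  obtain ⟨a, ha⟩ := nonempty_S5e
  exact dimension_le_of_prime prime_R2Poly
    (not_R2Poly_dvd ha.1.2 (by rw [eval_D1Poly]; exact ha.2.2.2.ne))
    (fun a ha => by rw [eval_R2Poly, h2 a ha]) fun a ha => by rw [eval_D1Poly, h a ha]

theorem dimension_le_of_D3_eq_zero {S : Set (Fin 6 → ℝ)} (h2 : ∀ a ∈ S, R2 a = 0)
    (h : ∀ a ∈ S, D3 a = 0) : dimension S ≤ (4 : ℕ) := by
  obtain ⟨a, ha⟩ := nonempty_S5c
  exact dimension_le_of_prime prime_R2Poly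
    (not_R2Poly_dvd ha.1.2 (by rw [eval_D3Poly]; exact ha.2.2.2.ne))
    (fun a ha => by rw [eval_R2Poly, h2 a ha]) fun a ha => by rw [eval_D3Poly, h a ha]

theorem dimension_S5a_le : dimension S5a ≤ (5 : ℕ) :=
  dimension_le_of_generators_of_relation X X (fun a _ i => by simp) R2Poly prime_R2Poly.ne_zero
    fun a ha => by
      simp only [eval_X]
      exact (eval_R2Poly a).trans ha.1.2

theorem dimension_S1a_le : dimension S1a ≤ (2 : ℕ) := by
  refine dimension_le_of_generators ![X 0, X 2] ![X 0, 0, X 1, -3 * X 1, 0, 0] fun a ha i => ?_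
  obtain ⟨h5, h4, h3, h1⟩ := ha
  fin_cases i <;> simp [h1, h4, h5]
  linarith

theorem dimension_S1b_le : dimension S1b ≤ (2 : ℕ) := by
  refine dimension_le_of_generators ![X 0, X 5] ![X 0, X 0 * X 1, -(X 0 ^ 2 * X 1),
    X 1 * (3 * X 0 ^ 2 - 1), -(4 * X 0 * X 1), X 1] fun a ha i => ?_
  obtain ⟨h1, h2, h3, h4⟩ := ha
  have e1 : a 1 = a 0 * a 5 := by linarith
  have e2 : a 2 = -(a 0 ^ 2 * a 5) := by linear_combination h4 - a 0 * e1
  -- The set is p₃ = 0; eliminating a₅ from the second and third equations leaves a₄ with the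
  -- coefficient 1 + a₁².
  have e3 : a 3 = a 5 * (3 * a 0 ^ 2 - 1) := by
    refine mul_left_cancel₀ (by positivity : 1 + a 0 ^ 2 ≠ 0) ?_
    linear_combination h2 + a 0 * h3 + 3 * a 0 * e1 + (1 - 3 * a 0 ^ 2) * e2
  have e4 : a 4 = -(4 * a 0 * a 5) := by
    linear_combination -h3 - 3 * e1 + 3 * a 0 * e2 + a 0 * e3
  fin_cases i <;> simp
  · linarith
  · linarith
  · linarith
  · linarith

theorem dimension_S2_le : dimension S2 ≤ (3 : ℕ) := by
  refine dimension_le_of_generators_of_relation ![X 0, X 1, X 2, X 3]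
    ![X 0, X 1, X 2, X 3, -3 * X 1, 0] (fun a ha i => ?_)
    (X 1 ^ 2 - X 2 * (3 * X 2 + X 3)) (fun h => ?_) fun a ha => ?_
  · obtain ⟨h5, h4, -⟩ := ha
    fin_cases i <;> simp [h5]
    linarith
  · have := congrArg (eval ![0, 1, 0, 0]) h
    simp at this
  · obtain ⟨h5, h4, h0, h2, -⟩ := ha
    have h4' : a 4 = -(3 * a 1) := by linarith
    simp only [R2, h5, h4'] at h2
    have h1 : a 1 ^ 2 ≠ 0 := pow_ne_zero 2 (right_ne_zero_of_mul h0)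
    simp
    refine mul_left_cancel₀ h1 ?_
    linear_combination h2

theorem dimension_S4_le : dimension S4 ≤ (3 : ℕ) := by
  refine dimension_le_of_generators ![X 0, X 2, X 4] ![X 0, 0, X 1, -3 * X 1, X 2, 0]
    fun a ha i => ?_
  obtain ⟨h1, h5, -, h3, -⟩ := ha
  fin_cases i <;> simp [h1, h5]
  linarith

theorem dimension_S3a_le : dimension S3a ≤ (3 : ℕ) := by
  let g : Fin 6 → MvPolynomial (Fin 4) ℝ :=
    ![X 0, X 0 * X 3, X 1, -(2 * X 1) - X 0 * (3 * (X 0 * X 3) + X 2) - X 3, X 2, X 3]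
  have hg : ∀ a ∈ S3a, ∀ i,
      eval (fun j => eval a ((![X 0, X 2, X 4, X 5] : Fin 4 → MvPolynomial (Fin 6) ℝ) j)) (g i) =
        a i := by
    rintro a ⟨⟨h1, h2, -⟩, -⟩ i
    fin_cases i <;> simp [g]
    · linarith
    · linear_combination -h2 + 3 * a 0 * h1
  refine dimension_le_of_generators_of_relation ![X 0, X 2, X 4, X 5] g hg (aeval g R2Poly)
    (fun h => ?_) fun a ha => ?_
  -- At a₁ = a₅ = 0, a₃ = a₆ = 1 the substitution gives a₂ = 0, a₄ = -3 and R₂ = 1.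
  · have := congrArg (eval ![0, 1, 0, 1]) h
    rw [← coe_aeval_eq_eval, RingHom.coe_coe, aeval_aeval_eq_eval, eval_R2Poly, map_zero] at this
    simp [R2, g] at this
    norm_num at this
  · rw [← coe_aeval_eq_eval, RingHom.coe_coe, aeval_aeval_eq_eval, funext (hg a ha), eval_R2Poly]
    exact ha.2.1

theorem dimension_S3b_le : dimension S3b ≤ (1 : ℕ) := by
  refine dimension_le_of_generators_of_relation ![X 0, X 5]
    ![X 0, X 0 * X 1, C (-5 / 4) * X 1, C (9 / 4) * X 1, -(9 * X 0 * X 1), X 1] (fun a ha i => ?_)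
    (8 * X 0 ^ 2 - 1) (fun h => ?_) fun a ha => ?_
  · obtain ⟨-, h3, h2, h1, h4, -⟩ := ha
    fin_cases i <;> simp <;> linarith
  · have := congrArg (eval 0) h
    simp at this
  · simpa using ha.2.2.2.2.2

/-! ### From dimension bounds to codimensions. -/

theorem exists_hasCodim_ge_two {S : Set (Fin 6 → ℝ)} (hS : S.Nonempty)
    (h : dimension S ≤ (4 : ℕ)) : ∃ c ≥ 2, HasCodim S c := by
  obtain ⟨c, hc, -, hcS⟩ := exists_hasCodim (d := 2) h (e := 0) (dimension_nonneg hS) (by norm_num)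
  exact ⟨c, hc, hcS⟩

theorem hasCodim_S5f : HasCodim S5f 2 ∨ HasCodim S5f 3 := by
  obtain ⟨c, hc, hc', h⟩ := exists_hasCodim (d := 2)
    (dimension_le_of_D1_eq_zero (fun a ha => ha.1.2) fun a ha => ha.2.1) le_dimension_S5f
    (by norm_num)
  obtain rfl | rfl : c = 2 ∨ c = 3 := by omega
  · exact Or.inl h
  · exact Or.inr h

end QuadraticSystem

theorem proposition4p10 :
    QuadraticSystem.HasCodim QuadraticSystem.S5a 1 ∧
    (QuadraticSystem.HasCodim QuadraticSystem.S5b 2 ∧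
      QuadraticSystem.HasCodim QuadraticSystem.S5d 2) ∧
    (QuadraticSystem.HasCodim QuadraticSystem.S2 3 ∧
      QuadraticSystem.HasCodim QuadraticSystem.S3a 3 ∧
      QuadraticSystem.HasCodim QuadraticSystem.S4 3) ∧
    (QuadraticSystem.HasCodim QuadraticSystem.S1a 4 ∧
      QuadraticSystem.HasCodim QuadraticSystem.S1b 4) ∧
    QuadraticSystem.HasCodim QuadraticSystem.S3b 5 ∧
    (QuadraticSystem.HasCodim QuadraticSystem.S5f 2 ∨
      QuadraticSystem.HasCodim QuadraticSystem.S5f 3) ∧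
    (∃ c ≥ 2, QuadraticSystem.HasCodim QuadraticSystem.S5c c) ∧
    (∃ c ≥ 2, QuadraticSystem.HasCodim QuadraticSystem.S5e c) ∧
    (∃ c ≥ 2, QuadraticSystem.HasCodim QuadraticSystem.S5g c) ∧
    (∃ c ≥ 2, QuadraticSystem.HasCodim QuadraticSystem.S5h c) := by
  open QuadraticSystem in
  exact ⟨hasCodim_of_le_of_le dimension_S5a_le le_dimension_S5a rfl,
    ⟨hasCodim_of_le_of_le (dimension_le_of_D1_eq_zero (fun a ha => ha.1.2) fun a ha => ha.2.1)
        le_dimension_S5b rfl,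
      hasCodim_of_le_of_le (dimension_le_of_D3_eq_zero (fun a ha => ha.1.2) fun a ha => ha.2.1)
        le_dimension_S5d rfl⟩,
    ⟨hasCodim_of_le_of_le dimension_S2_le le_dimension_S2 rfl,
      hasCodim_of_le_of_le dimension_S3a_le le_dimension_S3a rfl,
      hasCodim_of_le_of_le dimension_S4_le le_dimension_S4 rfl⟩,
    ⟨hasCodim_of_le_of_le dimension_S1a_le le_dimension_S1a rfl,
      hasCodim_of_le_of_le dimension_S1b_le le_dimension_S1b rfl⟩,
    hasCodim_of_le_of_le dimension_S3b_le le_dimension_S3b rfl,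
    hasCodim_S5f,
    exists_hasCodim_ge_two nonempty_S5c
      (dimension_le_of_D1_eq_zero (fun a ha => ha.1.2) fun a ha => ha.2.1),
    exists_hasCodim_ge_two nonempty_S5e
      (dimension_le_of_D3_eq_zero (fun a ha => ha.1.2) fun a ha => ha.2.1),
    exists_hasCodim_ge_two nonempty_S5g
      (dimension_le_of_D1_eq_zero (fun a ha => ha.1.2) fun a ha => ha.2.1),
    exists_hasCodim_ge_two nonempty_S5h
      (dimension_le_of_D1_eq_zero (fun a ha => ha.1.2) fun a ha => ha.2.1)⟩
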